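/- Identify the circle $S^1$ with $\mathbb{R}/2\pi\mathbb{Z}$ and functions on it with $2\pi$-periodic functions on $\mathbb{R}$. Let $\theta_1,\theta_2:S^1\to\mathbb{R}$ be smooth, $A=i\,\mathrm{diag}(\theta_1,\theta_2)$, and let $\mathcal{D}=-i\left(\frac{d}{dt}+A\right)$ be the covariant Dirac operator on $L^2(S^1,\mathbb{C}^2)$. Let $\mathcal{A}=C^\infty(S^1,M_2(\mathbb{C}))$ act by multiplication. The pure states of $\mathcal{A}$ are $\zeta_y(a)=\langle\zeta,a(y)\zeta\rangle$, $y\in S^1$, $\zeta\in\mathbb{C}P^1$ (represented by a unit vector); they form a bundle $P$ over $S^1$. The spectral distance is $$d(p,q)=\sup\{|p(a)-q(a)|\;:\;a\in\mathcal{A},\ \|[\mathcal{D},a]\|\le 1\}\in[0,+\infty].$$ The horizontal distance $d_H(p,q)$ is the infimum of the lengths of the base projections of the curves in $P$ from $p$ to $q$ that are horizontal for the connection $A$ ($+\infty$ if there are none). Put $\mathrm{Con}(p)=\{q\in P: d(p,q)<\infty\}$ and $\mathrm{Acc}(p)=\{q\in P: d_H(p,q)<\infty\}$. Let $\Theta_j(\tau)=\int_0^\tau\theta_j(t)\,dt$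 and $\omega=\frac{\Theta_1(2\pi)-\Theta_2(2\pi)}{2\pi}$. Let $x$ be the point of coordinate $0$ and let $\xi\in\mathbb{C}P^1$ be represented by the unit vector $(V_1,V_2)$. Put $V_j(\tau)=V_je^{-i\Theta_j(\tau)}$, $z_\xi=|V_1|^2-|V_2|^2$, $R=\sqrt{1-z_\xi^2}$, and let $\mathbb{T}_\xi\subset P$ be the set of the states given, over arbitrary points of $S^1$, by the vectors $(V_1,e^{i\varphi}V_2)$, $\varphi\in\mathbb{R}$. For $k\in\mathbb{Z}$, $0\le\tau_0\le2\pi$ and $\varphi\in\mathbb{R}$, let $\zeta_y\in\mathbb{T}_\xi$ be the state given, over the point $y$ of coordinate $\tau=2k\pi+\tau_0$ modulo $2\pi$, by the vector $(V_1(\tau),e^{i\varphi}V_2(\tau))$. (i) If the holonomy is trivial, that is $\Theta_1(2\pi)=\Theta_2(2\pi)$ modulo $2\pi$, then $\mathrm{Con}(\xi_x)=\mathrm{Acc}(\xi_x)$, and for all $(k,\tau_0,\varphi)$ $$d(\xi_x,\zeta_y)=\begin{cases}\min(\tau_0,2\pi-\tau_0)&\text{if }\varphi\in2\pi\mathbb{Z}\text{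 or }R=0,\\+\infty&\text{if }\varphi\notin2\pi\mathbb{Z}\text{ and }R\neq0.\end{cases}$$ (ii) Otherwise $\mathrm{Con}(\xi_x)=\mathbb{T}_\xi$, and for all $(k,\tau_0,\varphi)$ $$d(\xi_x,\zeta_y)=\max_{(T,\Delta)\in\mathcal{T}_\pm}H_\xi(T,\Delta),$$ where the maximum is attained, the sign is the one of $z_\xi$ (either sign if $z_\xi=0$), $$\mathcal{T}_\pm=\{(T,\Delta)\in\mathbb{R}^2:\ T\ge0,\ \pm\Delta\ge0,\ T\pm\Delta\le\min(\tau_0,2\pi-\tau_0)\},$$ $$H_\xi(T,\Delta)=T+z_\xi\Delta+RW_{k+1}\sqrt{(\tau_0-T)^2-\Delta^2}+RW_k\sqrt{(2\pi-\tau_0-T)^2-\Delta^2},$$ $$W_k=\frac{|\sin(k\omega\pi+\frac{\varphi}{2})|}{|\sin\omega\pi|}.$$ -/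

import Mathlib

open scoped ContDiff Matrix ENNReal

noncomputable section

namespace SpectralCircle

/-- The involutive algebra of smooth functions from the circle to the complex `n × n` matrices.
The circle is `ℝ / 2πℤ`, so its elements are the smooth `2π`-periodic matrix functions on `ℝ`,
with pointwise operations. -/
def loopAlgebra (n : ℕ) : StarSubalgebra ℂ (ℝ → Matrix (Fin n) (Fin n) ℂ) where
  carrier := {a | (∀ i j, ContDiff ℝ ∞ fun t => a t i j) ∧ Function.Periodic a (2 * Real.pi)}
  mul_mem' := by
    rintro a b ⟨ha, ha'⟩ ⟨hb, hb'⟩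
    refine ⟨fun i j => ?_, ha'.mul hb'⟩
    simp only [Pi.mul_apply, Matrix.mul_apply]
    exact ContDiff.sum fun l _ => (ha i l).mul (hb l j)
  add_mem' := by
    rintro a b ⟨ha, ha'⟩ ⟨hb, hb'⟩
    exact ⟨fun i j => (ha i j).add (hb i j), ha'.add hb'⟩
  algebraMap_mem' := by
    intro r
    refine ⟨fun i j => ?_, fun t => rfl⟩
    exact contDiff_const (c := (algebraMap ℂ (Matrix (Fin n) (Fin n) ℂ) r) i j)
  star_mem' := by
    rintro a ⟨ha, ha'⟩
    refine ⟨fun i j => ?_, fun t => ?_⟩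
    · exact Complex.conjCLE.contDiff.comp (ha j i)
    · change star (a _) = star (a _)
      rw [ha' t]

/-- The smooth spinors on the circle with values in `ℂⁿ`: a dense common domain for the Dirac
operator and its commutators in the Hilbert space of square integrable `ℂⁿ`-valued spinors. -/
def spinors (n : ℕ) : Submodule ℂ (ℝ → Fin n → ℂ) where
  carrier := {ψ | ContDiff ℝ ∞ ψ ∧ Function.Periodic ψ (2 * Real.pi)}
  add_mem' := by
    rintro a b ⟨ha, ha'⟩ ⟨hb, hb'⟩
    exact ⟨ha.add hb, ha'.add hb'⟩
  zero_mem' := ⟨contDiff_const, fun _ => rfl⟩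
  smul_mem' := by
    rintro c a ⟨ha, ha'⟩
    refine ⟨contDiff_const.smul ha, fun t => ?_⟩
    simp only [Pi.smul_apply, ha' t]

/-- The norm of the Hilbert space of square integrable `ℂⁿ`-valued spinors on the circle. -/
def l2Norm {n : ℕ} (ψ : ℝ → Fin n → ℂ) : ℝ :=
  √(∫ t in (0 : ℝ)..(2 * Real.pi), ∑ j, ‖ψ t j‖ ^ 2)

/-- The skew-adjoint gauge field `A = i diag(θ₁, …, θₙ)`. -/
def gaugeField {n : ℕ} (θ : Fin n → ℝ → ℝ) (t : ℝ) : Matrix (Fin n) (Fin n) ℂ :=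
  Matrix.diagonal fun j => Complex.I * (θ j t : ℂ)

/-- The covariant Dirac operator `-i (d/dt + A)`. -/
def dirac {n : ℕ} (θ : Fin n → ℝ → ℝ) (ψ : ℝ → Fin n → ℂ) : ℝ → Fin n → ℂ :=
  fun t => (-Complex.I) • (deriv ψ t + gaugeField θ t *ᵥ ψ t)

/-- The commutator of the covariant Dirac operator with the operator of multiplication
by the matrix function `a`, applied to the spinor `ψ`. -/
def diracCommutator {n : ℕ} (θ : Fin n → ℝ → ℝ) (a : ℝ → Matrix (Fin n) (Fin n) ℂ)
    (ψ : ℝ → Fin n → ℂ) : ℝ → Fin n → ℂ :=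
  dirac θ (fun t => a t *ᵥ ψ t) - fun t => a t *ᵥ dirac θ ψ t

/-- The operator norm of the commutator of the covariant Dirac operator with `a`. -/
def commutatorNorm {n : ℕ} (θ : Fin n → ℝ → ℝ) (a : loopAlgebra n) : ℝ≥0∞ :=
  ⨆ ψ : spinors n, ⨆ _ : l2Norm (ψ : ℝ → Fin n → ℂ) ≤ 1,
    ENNReal.ofReal (l2Norm (diracCommutator θ a ψ))

/-- The spectral distance between two linear functionals on the algebra. -/
def spectralDist {n : ℕ} (θ : Fin n → ℝ → ℝ) (p q : loopAlgebra n →ₗ[ℂ] ℂ) : ℝ≥0∞ :=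
  ⨆ a : loopAlgebra n, ⨆ _ : commutatorNorm θ a ≤ 1, ENNReal.ofReal ‖p a - q a‖

/-- The functional `a ↦ ⟨V, a(t) V⟩`. It depends on `t` modulo `2π` and on `V` up to a phase. -/
def vectorState {n : ℕ} (t : ℝ) (V : Fin n → ℂ) : loopAlgebra n →ₗ[ℂ] ℂ where
  toFun a := star V ⬝ᵥ ((a : ℝ → Matrix (Fin n) (Fin n) ℂ) t *ᵥ V)
  map_add' a b := by
    simp [Matrix.add_mulVec]
  map_smul' c a := by
    simp [Matrix.smul_mulVec]

/-- The bundle `P` of pure states over the circle: pairs of a point of the circle and a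
point of `ℂPⁿ⁻¹` (represented by a unit vector), seen as functionals on the algebra. -/
def pureStates (n : ℕ) : Set (loopAlgebra n →ₗ[ℂ] ℂ) :=
  {p | ∃ (t : ℝ) (V : Fin n → ℂ), star V ⬝ᵥ V = 1 ∧ p = vectorState t V}

/-- The pair `(γ, V)` is a lift to `ℝ × ℂⁿ` of a horizontal curve in the bundle of pure states:
`V` is transported parallelly, `V' = -γ' A(γ) V`, along the base curve `γ`. -/
def IsHorizontal {n : ℕ} (θ : Fin n → ℝ → ℝ) (γ : ℝ → ℝ) (V : ℝ → Fin n → ℂ) : Prop :=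
  ContDiff ℝ 1 γ ∧
    ∀ t, HasDerivAt V (-(((deriv γ t : ℝ) : ℂ) • (gaugeField θ (γ t) *ᵥ V t))) t

/-- The horizontal (Carnot-Carathéodory) distance: the infimum of the lengths of the base
projections of horizontal curves `[0,1] → P` from `p` to `q`. -/
def horizontalDist {n : ℕ} (θ : Fin n → ℝ → ℝ) (p q : loopAlgebra n →ₗ[ℂ] ℂ) : ℝ≥0∞ :=
  ⨅ (γ : ℝ → ℝ) (V : ℝ → Fin n → ℂ) (_ : IsHorizontal θ γ V)
    (_ : p = vectorState (γ 0) (V 0)) (_ : q = vectorState (γ 1) (V 1)),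
    ENNReal.ofReal (∫ t in (0 : ℝ)..1, |deriv γ t|)

/-- The pure states at finite spectral distance from `p`. -/
def Con {n : ℕ} (θ : Fin n → ℝ → ℝ) (p : loopAlgebra n →ₗ[ℂ] ℂ) :
    Set (loopAlgebra n →ₗ[ℂ] ℂ) :=
  {q ∈ pureStates n | spectralDist θ p q < ⊤}

/-- The pure states at finite horizontal distance from `p`. -/
def Acc {n : ℕ} (θ : Fin n → ℝ → ℝ) (p : loopAlgebra n →ₗ[ℂ] ℂ) :
    Set (loopAlgebra n →ₗ[ℂ] ℂ) :=
  {q ∈ pureStates n | horizontalDist θ p q < ⊤}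

/-- `Θ_j(τ) = ∫₀^τ θ_j`. -/
def Theta {n : ℕ} (θ : Fin n → ℝ → ℝ) (j : Fin n) (τ : ℝ) : ℝ :=
  ∫ t in (0 : ℝ)..τ, θ j t

/-- Two directions are far from each other if the corresponding components of the holonomy
are equal, that is `Θ_i(2π) = Θ_j(2π)` modulo `2π`. -/
def Far {n : ℕ} (θ : Fin n → ℝ → ℝ) (i j : Fin n) : Prop :=
  ∃ m : ℤ, Theta θ i (2 * Real.pi) = Theta θ j (2 * Real.pi) + 2 * Real.pi * m

/-- The vector `V(τ)` with components `V_j e^{-iΘ_j(τ)}`. -/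
def liftVec {n : ℕ} (θ : Fin n → ℝ → ℝ) (V : Fin n → ℂ) (τ : ℝ) : Fin n → ℂ :=
  fun j => V j * Complex.exp (-(Complex.I * (Theta θ j τ : ℂ)))

/-- The vector `(U₁, e^{iφ} U₂)`. -/
def rotate (φ : ℝ) (U : Fin 2 → ℂ) : Fin 2 → ℂ :=
  ![U 0, Complex.exp (Complex.I * (φ : ℂ)) * U 1]

/-- The torus of all pure states, on all fibers, given by the vectors `(V₁, e^{iφ} V₂)`. -/
def torus (V : Fin 2 → ℂ) : Set (loopAlgebra 2 →ₗ[ℂ] ℂ) :=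
  {p | ∃ t φ : ℝ, p = vectorState t (rotate φ V)}

/-- The state of the torus with parameters `(k, τ₀, φ)`: with `τ = 2kπ + τ₀`, it is given by
the vector `(V₁(τ), e^{iφ} V₂(τ))` over the point of coordinate `τ`. -/
def torusState (θ : Fin 2 → ℝ → ℝ) (V : Fin 2 → ℂ) (k : ℤ) (τ₀ φ : ℝ) :
    loopAlgebra 2 →ₗ[ℂ] ℂ :=
  vectorState (2 * k * Real.pi + τ₀) (rotate φ (liftVec θ V (2 * k * Real.pi + τ₀)))

/-- `z_ξ = |V₁|² - |V₂|²`. -/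
def altitude (V : Fin 2 → ℂ) : ℝ := ‖V 0‖ ^ 2 - ‖V 1‖ ^ 2

/-- `R = √(1 - z_ξ²)`. -/
def radius (V : Fin 2 → ℂ) : ℝ := √(1 - altitude V ^ 2)

/-- `ω = (Θ₁(2π) - Θ₂(2π)) / 2π`. -/
def omega (θ : Fin 2 → ℝ → ℝ) : ℝ :=
  (Theta θ 0 (2 * Real.pi) - Theta θ 1 (2 * Real.pi)) / (2 * Real.pi)

/-- `W_k = |sin(kωπ + φ/2)| / |sin ωπ|`. -/
def W (θ : Fin 2 → ℝ → ℝ) (φ : ℝ) (k : ℤ) : ℝ :=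
  |Real.sin (k * omega θ * Real.pi + φ / 2)| / |Real.sin (omega θ * Real.pi)|

/-- The function `H_ξ(T, Δ)`, of the pair `x = (T, Δ)`. -/
def H (θ : Fin 2 → ℝ → ℝ) (V : Fin 2 → ℂ) (k : ℤ) (τ₀ φ : ℝ) (x : ℝ × ℝ) : ℝ :=
  x.1 + altitude V * x.2 + radius V * W θ φ (k + 1) * √((τ₀ - x.1) ^ 2 - x.2 ^ 2)
    + radius V * W θ φ k * √((2 * Real.pi - τ₀ - x.1) ^ 2 - x.2 ^ 2)

/-- The triangle of the pairs `(T, Δ)` with `0 ≤ T`, `0 ≤ sΔ` and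
`T + sΔ ≤ min(τ₀, 2π - τ₀)`, where `s = ±1`. -/
def triangle (s τ₀ : ℝ) : Set (ℝ × ℝ) :=
  {x | 0 ≤ x.1 ∧ 0 ≤ s * x.2 ∧ x.1 + s * x.2 ≤ min τ₀ (2 * Real.pi - τ₀)}

end SpectralCircle

end

noncomputable section

namespace SpectralCircle

open MeasureTheory
open scoped Matrix.Norms.L2Operator

/-! The commutator `[D, a]` is multiplication by the matrix `a' + [A, a]` up to the factor `-i`, so
the constraint on `a` is a pointwise bound on an operator norm. In the parallel frame, `b(t) =
e^{iΘ(t)} a(t) e^{-iΘ(t)}`, it says that `b` is 1-Lipschitz. Periodicity of `a` becomes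
quasi-periodicity: `b(t + 2π)` is `b(t)` conjugated by the holonomy. A parallel family of states
becomes one fixed vector.

The distance then depends only on `B₀ = b(0)` and `B₁ = b(τ₀)`, and these are constrained only by
`‖B₁ - B₀‖ ≤ τ₀` and `‖hol B₀ - B₁‖ ≤ 2π - τ₀`. Necessity is `spectralDist_le`, which also reduces
to Hermitian matrices; sufficiency is `le_spectralDist`, by piecewise affine interpolation followed
by mollification.

For `2 × 2` matrices the two increments have opposite diagonals `±(T + D, T - D)`, because
conjugation by phases fixes diagonals, and off-diagonal entries `g`, `g'`. Since the norm is `|T| +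
√(D² + |g|²)`, the constraints give the triangle and bound `|g|`, `|g'|` by the square roots in `H`.
If the holonomy is not trivial, `g` and `g'` are independent; the gap between the two states is `T +
zD` plus a real linear form in `g`, `g'` whose coefficients have moduli `R W_{k+1}` and `R W_k`.
Aligning the phases yields `H`. If the holonomy is trivial, constant off-diagonal observables are
unconstrained and separate at infinite distance any two states whose relative phases differ. -/

variable {n : ℕ}

/-! ### The commutator norm as a supremum of pointwise operator norms. -/

/-- The matrix `a' + [A, a]`, whose product with a spinor is the commutator of the
Dirac operator up to the factor `-i`. -/
def covDeriv (θ : Fin n → ℝ → ℝ) (a : ℝ → Matrix (Fin n) (Fin n) ℂ) (t : ℝ) :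
    Matrix (Fin n) (Fin n) ℂ :=
  Matrix.of fun i j =>
    deriv (fun s => a s i j) t + Complex.I * ((θ i t - θ j t : ℝ) : ℂ) * a t i j

lemma loopAlgebra_hasDerivAt (a : loopAlgebra n) (i j : Fin n) (t : ℝ) :
    HasDerivAt (fun s => (a : ℝ → Matrix (Fin n) (Fin n) ℂ) s i j)
      (deriv (fun s => (a : ℝ → Matrix (Fin n) (Fin n) ℂ) s i j) t) t :=
  ((a.2.1 i j).differentiable (by simp)).differentiableAt.hasDerivAt

/-- By the Leibniz rule the terms in `ψ'` cancel, so the commutator is an operator of order zero. -/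
lemma diracCommutator_eq (θ : Fin n → ℝ → ℝ) (a : loopAlgebra n) {ψ : ℝ → Fin n → ℂ}
    (hψ : Differentiable ℝ ψ) (t : ℝ) :
    diracCommutator θ a ψ t = (-Complex.I) • (covDeriv θ a t *ᵥ ψ t) := by
  have hψ' : ∀ j, HasDerivAt (fun s => ψ s j) (deriv ψ t j) t := fun j =>
    (hasDerivAt_pi.1 (hψ t).hasDerivAt) j
  have h : HasDerivAt (fun s => (a : ℝ → Matrix (Fin n) (Fin n) ℂ) s *ᵥ ψ s)
      (fun i => ∑ j, (deriv (fun s => (a : ℝ → Matrix (Fin n) (Fin n) ℂ) s i j) t * ψ t j +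
        (a : ℝ → Matrix (Fin n) (Fin n) ℂ) t i j * deriv ψ t j)) t := by
    refine hasDerivAt_pi.2 fun i => ?_
    simp only [Matrix.mulVec, dotProduct]
    exact HasDerivAt.fun_sum fun j _ => (loopAlgebra_hasDerivAt a i j t).mul (hψ' j)
  funext i
  simp only [diracCommutator, dirac, Pi.sub_apply, h.deriv, gaugeField, Matrix.mulVec_smul,
    Pi.smul_apply, Pi.add_apply, Matrix.mulVec_add, Matrix.mulVec_diagonal, smul_eq_mul]
  simp only [Matrix.mulVec, dotProduct, covDeriv, Matrix.of_apply, Matrix.diagonal_apply,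
    ite_mul, zero_mul, Finset.sum_ite_eq, Finset.mem_univ, if_true, Finset.mul_sum,
    ← Finset.sum_add_distrib, ← Finset.sum_sub_distrib]
  refine Finset.sum_congr rfl fun j _ => ?_
  push_cast
  ring

lemma norm_toLp_sq (v : Fin n → ℂ) : ‖WithLp.toLp 2 v‖ ^ 2 = ∑ j, ‖v j‖ ^ 2 := by
  rw [EuclideanSpace.norm_sq_eq]

lemma norm_toLp_mulVec_le (M : Matrix (Fin n) (Fin n) ℂ) (v : Fin n → ℂ) :
    ‖WithLp.toLp 2 (M *ᵥ v)‖ ≤ ‖M‖ * ‖WithLp.toLp 2 v‖ :=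
  M.l2_opNorm_mulVec (WithLp.toLp 2 v)

lemma opNorm_le_of_forall {M : Matrix (Fin n) (Fin n) ℂ} {c : ℝ} (hc : 0 ≤ c)
    (h : ∀ v : Fin n → ℂ, ‖WithLp.toLp 2 (M *ᵥ v)‖ ≤ c * ‖WithLp.toLp 2 v‖) : ‖M‖ ≤ c := by
  rw [Matrix.cstar_norm_def]
  exact ContinuousLinearMap.opNorm_le_bound _ hc fun v => h v.ofLp

lemma continuous_covDeriv {θ : Fin n → ℝ → ℝ} (hθ : ∀ j, Continuous (θ j)) (a : loopAlgebra n)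
    (i j : Fin n) : Continuous fun t => covDeriv θ a t i j := by
  have h1 := (a.2.1 i j).continuous_deriv (by simp)
  have h2 := (a.2.1 i j).continuous
  have := hθ i
  have := hθ j
  simp only [covDeriv, Matrix.of_apply]
  fun_prop

lemma l2Norm_smul (c : ℂ) (ψ : ℝ → Fin n → ℂ) : l2Norm (c • ψ) = ‖c‖ * l2Norm ψ := by
  simp only [l2Norm, Pi.smul_apply, norm_smul, mul_pow, ← Finset.mul_sum,
    intervalIntegral.integral_const_mul]
  rw [Real.sqrt_mul (by positivity), Real.sqrt_sq (norm_nonneg c)]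

lemma diracCommutator_smul (θ : Fin n → ℝ → ℝ) (a : loopAlgebra n) (c : ℂ) {ψ : ℝ → Fin n → ℂ}
    (hψ : Differentiable ℝ ψ) :
    diracCommutator θ a (c • ψ) = c • diracCommutator θ a ψ := by
  funext t
  rw [diracCommutator_eq θ a (hψ.const_smul c), Pi.smul_apply, Pi.smul_apply,
    diracCommutator_eq θ a hψ, Matrix.mulVec_smul, smul_comm]

lemma l2Norm_diracCommutator_le {θ : Fin n → ℝ → ℝ} {a : loopAlgebra n}
    (h : commutatorNorm θ a ≤ 1) (ψ : spinors n) (hψ : 0 < l2Norm (ψ : ℝ → Fin n → ℂ)) :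
    l2Norm (diracCommutator θ a ψ) ≤ l2Norm (ψ : ℝ → Fin n → ℂ) := by
  set r := l2Norm (ψ : ℝ → Fin n → ℂ)
  have h1 : l2Norm (((((r⁻¹ : ℝ) : ℂ) • ψ : spinors n)) : ℝ → Fin n → ℂ) ≤ 1 := by
    rw [Submodule.coe_smul, l2Norm_smul, Complex.norm_real, Real.norm_of_nonneg (by positivity)]
    exact (inv_mul_cancel₀ hψ.ne').le
  have h2 := (le_iSup₂ (f := fun (ψ : spinors n) (_ : l2Norm (ψ : ℝ → Fin n → ℂ) ≤ 1) =>
    ENNReal.ofReal (l2Norm (diracCommutator θ a ψ))) _ h1).trans h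
  rw [Submodule.coe_smul, diracCommutator_smul θ a _ (ψ.2.1.differentiable (by simp)),
    l2Norm_smul, Complex.norm_real, Real.norm_of_nonneg (by positivity),
    ENNReal.ofReal_le_one] at h2
  rwa [inv_mul_le_iff₀ hψ, mul_one] at h2

lemma diracCommutator_sum_sq (θ : Fin n → ℝ → ℝ) (a : loopAlgebra n) {ψ : ℝ → Fin n → ℂ}
    (hψ : Differentiable ℝ ψ) (t : ℝ) :
    ∑ j, ‖diracCommutator θ a ψ t j‖ ^ 2 = ‖WithLp.toLp 2 (covDeriv θ a t *ᵥ ψ t)‖ ^ 2 := by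
  rw [norm_toLp_sq, diracCommutator_eq θ a hψ]
  simp

lemma commutatorNorm_le_one {θ : Fin n → ℝ → ℝ} (hθ : ∀ j, Continuous (θ j)) {a : loopAlgebra n}
    (h : ∀ t, ‖covDeriv θ a t‖ ≤ 1) : commutatorNorm θ a ≤ 1 := by
  refine iSup₂_le fun ψ hψ => ?_
  rw [ENNReal.ofReal_le_one]
  refine le_trans (Real.sqrt_le_sqrt ?_) hψ
  have hd := ψ.2.1.differentiable (by simp)
  have hc : ∀ j, Continuous fun t => (ψ : ℝ → Fin n → ℂ) t j := fun j =>
    (continuous_apply j).comp ψ.2.1.continuous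
  simp only [diracCommutator_sum_sq θ a hd]
  refine intervalIntegral.integral_mono_on (by positivity) ?_ ?_ fun t _ => ?_
  · refine Continuous.intervalIntegrable ?_ _ _
    simp only [norm_toLp_sq, Matrix.mulVec, dotProduct]
    have := continuous_covDeriv hθ a
    fun_prop
  · exact Continuous.intervalIntegrable (by fun_prop) _ _
  · rw [← norm_toLp_sq]
    gcongr
    exact (norm_toLp_mulVec_le _ _).trans (mul_le_of_le_one_left (norm_nonneg _) (h t))

lemma covDeriv_periodic {θ : Fin n → ℝ → ℝ} (hper : ∀ j, Function.Periodic (θ j) (2 * Real.pi))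
    (a : loopAlgebra n) : Function.Periodic (covDeriv θ a) (2 * Real.pi) := by
  intro t
  ext i j
  have hd : deriv (fun s => (a : ℝ → Matrix (Fin n) (Fin n) ℂ) s i j) (t + 2 * Real.pi) =
      deriv (fun s => (a : ℝ → Matrix (Fin n) (Fin n) ℂ) s i j) t := by
    rw [← deriv_comp_add_const]
    congr 1
    funext s
    rw [a.2.2 s]
  simp only [covDeriv, Matrix.of_apply, hd, hper i t, hper j t, a.2.2 t]

/-- If some `v` were stretched at `t₀`, it would be stretched nearby by continuity, and the spinor
`f v`, with `f` a bump near `t₀`, would have its `L²` norm strictly increased by the commutator. -/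
lemma norm_covDeriv_le_one {θ : Fin n → ℝ → ℝ} (hθ : ∀ j, Continuous (θ j))
    (hper : ∀ j, Function.Periodic (θ j) (2 * Real.pi)) {a : loopAlgebra n}
    (h : commutatorNorm θ a ≤ 1) (t₀ : ℝ) : ‖covDeriv θ a t₀‖ ≤ 1 := by
  refine opNorm_le_of_forall zero_le_one fun v => ?_
  rw [one_mul]
  by_contra! hv
  set F : ℝ → ℝ := fun t => ‖WithLp.toLp 2 (covDeriv θ a t *ᵥ v)‖ ^ 2 with hF
  have hFc : Continuous F := by
    simp only [hF, norm_toLp_sq, Matrix.mulVec, dotProduct]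
    have := continuous_covDeriv hθ a
    fun_prop
  have hFper : Function.Periodic F (2 * Real.pi) := fun t => by
    simp only [hF, covDeriv_periodic hper a t]
  have hFt : ‖WithLp.toLp 2 v‖ ^ 2 < F t₀ := by
    simp only [hF]
    gcongr
  have hv0 : 0 < ‖WithLp.toLp 2 v‖ := by
    rw [norm_pos_iff]
    intro h0
    have : v = 0 := by simpa using h0
    simp [this] at hv
  obtain ⟨δ, hδ, hδF⟩ := Metric.eventually_nhds_iff.1
    (hFc.continuousAt.eventually_const_lt hFt)
  set δ' := min (δ / 2) 1 with hδ'
  have hδ'0 : 0 < δ' := by positivity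
  have hδ'1 : δ' ≤ Real.pi := (min_le_right _ _).trans (by linarith [Real.pi_gt_three])
  have hδ'δ : δ' < δ := (min_le_left _ _).trans_lt (by linarith)
  -- A smooth bump that is already periodic: it is positive exactly where `cos (t - t₀) > cos δ'`,
  -- that is within `δ'` of `t₀` modulo `2π`.
  set f : ℝ → ℝ := fun t => expNegInvGlue (Real.cos (t - t₀) - Real.cos δ') with hf
  have hfs : ContDiff ℝ ∞ f := expNegInvGlue.contDiff.comp (by fun_prop)
  have hfper : Function.Periodic f (2 * Real.pi) := fun t => by
    simp only [hf]
    rw [show t + 2 * Real.pi - t₀ = t - t₀ + 2 * Real.pi by ring, Real.cos_add_two_pi]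
  have hfnear : ∀ t ∈ Set.Icc (t₀ - Real.pi) (t₀ + Real.pi), f t ≠ 0 → |t - t₀| < δ := by
    intro t ht hft
    by_contra! hcon
    refine hft (expNegInvGlue.zero_of_nonpos ?_)
    rw [← Real.cos_abs (t - t₀)]
    have := Real.cos_le_cos_of_nonneg_of_le_pi hδ'0.le
      (abs_le.2 ⟨by linarith [ht.1], by linarith [ht.2]⟩ : |t - t₀| ≤ Real.pi) (by linarith)
    linarith
  have hft₀ : 0 < f t₀ := by
    refine expNegInvGlue.pos_of_pos ?_
    rw [sub_self, Real.cos_zero, sub_pos, ← Real.cos_zero]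
    exact Real.cos_lt_cos_of_nonneg_of_le_pi le_rfl hδ'1 hδ'0
  let ψ : spinors n := ⟨fun t => (f t : ℂ) • v, by
    refine ⟨?_, fun t => by simp only [hfper t]⟩
    exact (Complex.ofRealCLM.contDiff.comp hfs).smul contDiff_const⟩
  -- The period is recentred at `t₀`, so that only one copy of the bump is met.
  have hψ1 : l2Norm (ψ : ℝ → Fin n → ℂ) =
      √(∫ t in (t₀ - Real.pi)..(t₀ + Real.pi), f t ^ 2 * ‖WithLp.toLp 2 v‖ ^ 2) := by
    have hper' : Function.Periodic (fun t => f t ^ 2 * ‖WithLp.toLp 2 v‖ ^ 2) (2 * Real.pi) :=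
      fun t => by simp only [hfper t]
    have := hper'.intervalIntegral_add_eq 0 (t₀ - Real.pi)
    rw [zero_add, show t₀ - Real.pi + 2 * Real.pi = t₀ + Real.pi by ring] at this
    rw [← this, l2Norm]
    simp [ψ, norm_toLp_sq, mul_pow, Finset.mul_sum]
  have hψ2 : l2Norm (diracCommutator θ a ψ) =
      √(∫ t in (t₀ - Real.pi)..(t₀ + Real.pi), f t ^ 2 * F t) := by
    have hper' : Function.Periodic (fun t => f t ^ 2 * F t) (2 * Real.pi) :=
      fun t => by simp only [hfper t, hFper t]
    have := hper'.intervalIntegral_add_eq 0 (t₀ - Real.pi)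
    rw [zero_add, show t₀ - Real.pi + 2 * Real.pi = t₀ + Real.pi by ring] at this
    rw [← this, l2Norm]
    simp only [diracCommutator_sum_sq θ a (ψ.2.1.differentiable (by simp))]
    simp [ψ, hF, Matrix.mulVec_smul, WithLp.toLp_smul, norm_smul, mul_pow]
  have hlt : t₀ - Real.pi < t₀ + Real.pi := by linarith [Real.pi_pos]
  have hmem : t₀ ∈ Set.Icc (t₀ - Real.pi) (t₀ + Real.pi) :=
    ⟨by linarith [Real.pi_pos], by linarith [Real.pi_pos]⟩
  have hfc := hfs.continuous
  have hI1 : 0 < ∫ t in (t₀ - Real.pi)..(t₀ + Real.pi), f t ^ 2 * ‖WithLp.toLp 2 v‖ ^ 2 :=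
    intervalIntegral.integral_pos hlt (by fun_prop) (fun t _ => by positivity)
      ⟨t₀, hmem, by positivity⟩
  have hI2 : ∫ t in (t₀ - Real.pi)..(t₀ + Real.pi), f t ^ 2 * ‖WithLp.toLp 2 v‖ ^ 2 <
      ∫ t in (t₀ - Real.pi)..(t₀ + Real.pi), f t ^ 2 * F t := by
    refine intervalIntegral.integral_lt_integral_of_continuousOn_of_le_of_exists_lt hlt
      (by fun_prop) (by fun_prop) (fun t ht => ?_) ⟨t₀, hmem, by gcongr⟩
    by_cases h0 : f t = 0
    · simp [h0]
    · have := hδF (hfnear t ⟨ht.1.le, ht.2⟩ h0)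
      gcongr
  refine absurd (l2Norm_diracCommutator_le h ψ ?_) (not_le.2 ?_)
  · rw [hψ1]
    positivity
  · rw [hψ1, hψ2]
    exact Real.sqrt_lt_sqrt hI1.le hI2

/-! ### The parallel frame: conjugation by phases, Lipschitz bound and quasi-periodicity. -/

/-- Conjugation of a matrix by the unitary diagonal matrix of phases `e^{i x_j}`. -/
def gauge (x : Fin n → ℝ) : Matrix (Fin n) (Fin n) ℂ →L[ℂ] Matrix (Fin n) (Fin n) ℂ :=
  LinearMap.toContinuousLinearMap
    { toFun := fun M => Matrix.of fun i j => Complex.exp (Complex.I * ((x i - x j : ℝ) : ℂ)) * M i j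
      map_add' := fun M N => by ext; simp [mul_add]
      map_smul' := fun c M => by ext; simp [mul_left_comm] }

lemma gauge_apply (x : Fin n → ℝ) (M : Matrix (Fin n) (Fin n) ℂ) (i j : Fin n) :
    gauge x M i j = Complex.exp (Complex.I * ((x i - x j : ℝ) : ℂ)) * M i j := rfl

lemma gauge_gauge (x y : Fin n → ℝ) (M : Matrix (Fin n) (Fin n) ℂ) :
    gauge x (gauge y M) = gauge (x + y) M := by
  ext i j
  rw [gauge_apply, gauge_apply, gauge_apply, ← mul_assoc, ← Complex.exp_add]
  congr 2
  simp only [Pi.add_apply]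
  push_cast
  ring

lemma gauge_zero (M : Matrix (Fin n) (Fin n) ℂ) : gauge 0 M = M := by
  ext i j
  simp [gauge_apply]

lemma gauge_star (x : Fin n → ℝ) (M : Matrix (Fin n) (Fin n) ℂ) : gauge x Mᴴ = (gauge x M)ᴴ := by
  ext i j
  rw [gauge_apply, Matrix.conjTranspose_apply, Matrix.conjTranspose_apply, gauge_apply, star_mul',
    Complex.star_def, ← Complex.exp_conj, map_mul, Complex.conj_I, Complex.conj_ofReal]
  congr 2
  push_cast
  ring

/-- Multiplication of the components of a vector by the phases `e^{i x_j}`. -/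
def phase (x : Fin n → ℝ) (v : Fin n → ℂ) : Fin n → ℂ :=
  fun j => Complex.exp (Complex.I * (x j : ℂ)) * v j

lemma gauge_mulVec (x : Fin n → ℝ) (M : Matrix (Fin n) (Fin n) ℂ) (v : Fin n → ℂ) :
    gauge x M *ᵥ v = phase x (M *ᵥ phase (-x) v) := by
  funext i
  simp only [Matrix.mulVec, dotProduct, phase, gauge_apply, Finset.mul_sum]
  refine Finset.sum_congr rfl fun j _ => ?_
  have : Complex.exp (Complex.I * ((x i - x j : ℝ) : ℂ)) =
      Complex.exp (Complex.I * (x i : ℂ)) * Complex.exp (Complex.I * ((-x) j : ℝ)) := by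
    rw [← Complex.exp_add]
    congr 1
    simp only [Pi.neg_apply]
    push_cast
    ring
  rw [this]
  ring

lemma norm_phase (x : Fin n → ℝ) (v : Fin n → ℂ) :
    ‖WithLp.toLp 2 (phase x v)‖ = ‖WithLp.toLp 2 v‖ := by
  rw [← sq_eq_sq₀ (norm_nonneg _) (norm_nonneg _), norm_toLp_sq, norm_toLp_sq]
  simp [phase, mul_comm Complex.I, Complex.norm_exp_ofReal_mul_I]

lemma norm_gauge (x : Fin n → ℝ) (M : Matrix (Fin n) (Fin n) ℂ) : ‖gauge x M‖ = ‖M‖ := by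
  have key : ∀ (x : Fin n → ℝ) (M : Matrix (Fin n) (Fin n) ℂ), ‖gauge x M‖ ≤ ‖M‖ := by
    intro x M
    refine opNorm_le_of_forall (norm_nonneg _) fun v => ?_
    rw [gauge_mulVec, norm_phase]
    refine (norm_toLp_mulVec_le _ _).trans_eq ?_
    rw [norm_phase]
  refine le_antisymm (key x M) ?_
  have := key (-x) (gauge x M)
  rwa [gauge_gauge, neg_add_cancel, gauge_zero] at this

lemma star_dotProduct_gauge (x : Fin n → ℝ) (M : Matrix (Fin n) (Fin n) ℂ) (v : Fin n → ℂ) :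
    star v ⬝ᵥ gauge x M *ᵥ v = star (phase (-x) v) ⬝ᵥ M *ᵥ phase (-x) v := by
  rw [gauge_mulVec]
  simp only [dotProduct, phase, Pi.star_apply, star_mul', Complex.star_def, ← Complex.exp_conj,
    map_mul, Complex.conj_I, Complex.conj_ofReal, Pi.neg_apply]
  refine Finset.sum_congr rfl fun j _ => ?_
  push_cast
  ring_nf

lemma norm_star_dotProduct_mulVec_le_mul (M : Matrix (Fin n) (Fin n) ℂ) (v : Fin n → ℂ) :
    ‖star v ⬝ᵥ M *ᵥ v‖ ≤ ‖M‖ * ‖WithLp.toLp 2 v‖ ^ 2 := by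
  have h2 : star v ⬝ᵥ M *ᵥ v = inner ℂ (WithLp.toLp 2 v) (WithLp.toLp 2 (M *ᵥ v)) := by
    rw [EuclideanSpace.inner_toLp_toLp, dotProduct_comm]
  rw [h2]
  refine (norm_inner_le_norm _ _).trans ?_
  have := mul_le_mul_of_nonneg_left (norm_toLp_mulVec_le M v) (norm_nonneg (WithLp.toLp 2 v))
  linarith

lemma star_dotProduct_self_eq (v : Fin n → ℂ) :
    star v ⬝ᵥ v = ((∑ j, ‖v j‖ ^ 2 : ℝ) : ℂ) := by
  push_cast
  simp [dotProduct, Complex.conj_mul']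

lemma norm_star_dotProduct_mulVec_le (M : Matrix (Fin n) (Fin n) ℂ) {v : Fin n → ℂ}
    (hv : star v ⬝ᵥ v = 1) : ‖star v ⬝ᵥ M *ᵥ v‖ ≤ ‖M‖ := by
  have h2 : ‖WithLp.toLp 2 v‖ ^ 2 = 1 := by
    rw [star_dotProduct_self_eq, ← norm_toLp_sq] at hv
    exact_mod_cast hv
  simpa [h2] using norm_star_dotProduct_mulVec_le_mul M v

instance : CompleteSpace (Matrix (Fin n) (Fin n) ℂ) := FiniteDimensional.complete ℂ _

/-- The evaluation of the entry `(i, j)` of a matrix. -/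
def entryCLM (i j : Fin n) : Matrix (Fin n) (Fin n) ℂ →L[ℝ] ℂ :=
  LinearMap.toContinuousLinearMap
    { toFun := fun M => M i j
      map_add' := fun _ _ => rfl
      map_smul' := fun _ _ => rfl }

/-- Matrices carry the operator norm here, not the product norm, so the entrywise derivatives are
assembled through the basis of elementary matrices. -/
lemma hasDerivAt_matrix {b : ℝ → Matrix (Fin n) (Fin n) ℂ} {b' : Matrix (Fin n) (Fin n) ℂ} {t : ℝ}
    (h : ∀ i j, HasDerivAt (fun s => b s i j) (b' i j) t) : HasDerivAt b b' t := by
  have : ∀ M : Matrix (Fin n) (Fin n) ℂ,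
      M = ∑ i, ∑ j, M i j • (Matrix.single i j 1 : Matrix (Fin n) (Fin n) ℂ) := fun M => by
    conv_lhs => rw [Matrix.matrix_eq_sum_single M]
    simp
  rw [this b', funext fun s => this (b s)]
  exact HasDerivAt.fun_sum fun i _ => HasDerivAt.fun_sum fun j _ => (h i j).smul_const _

lemma hasDerivAt_Theta {θ : Fin n → ℝ → ℝ} (hθ : ∀ j, Continuous (θ j)) (j : Fin n) (t : ℝ) :
    HasDerivAt (Theta θ j) (θ j t) t :=
  intervalIntegral.integral_hasDerivAt_right ((hθ j).intervalIntegrable _ _)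
    ((hθ j).stronglyMeasurableAtFilter _ _) (hθ j).continuousAt

lemma Theta_zero (θ : Fin n → ℝ → ℝ) (j : Fin n) : Theta θ j 0 = 0 := by simp [Theta]

lemma Theta_add_two_pi {θ : Fin n → ℝ → ℝ} (hθ : ∀ j, Continuous (θ j))
    (hper : ∀ j, Function.Periodic (θ j) (2 * Real.pi)) (j : Fin n) (t : ℝ) :
    Theta θ j (t + 2 * Real.pi) = Theta θ j t + Theta θ j (2 * Real.pi) := by
  have := (hper j).intervalIntegral_add_eq_add 0 t fun a b => (hθ j).intervalIntegrable a b
  simpa [Theta] using this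

lemma Theta_contDiff {θ : Fin n → ℝ → ℝ} (hθ : ∀ j, ContDiff ℝ ∞ (θ j)) (j : Fin n) :
    ContDiff ℝ ∞ (Theta θ j) := by
  rw [contDiff_infty_iff_deriv]
  have h := hasDerivAt_Theta (fun j => (hθ j).continuous) j
  refine ⟨fun t => (h t).differentiableAt, ?_⟩
  rw [funext fun t => (h t).deriv]
  exact hθ j

/-- The phases of the holonomy. -/
def hol (θ : Fin n → ℝ → ℝ) : Fin n → ℝ := fun j => Theta θ j (2 * Real.pi)

/-- Differentiating the phases produces exactly the term `[A, a]`: in the parallel frame the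
covariant derivative is the ordinary one. -/
lemma hasDerivAt_gauge {θ : Fin n → ℝ → ℝ} (hθ : ∀ j, Continuous (θ j)) (a : loopAlgebra n)
    (t : ℝ) : HasDerivAt (fun s => gauge (fun j => Theta θ j s)
      ((a : ℝ → Matrix (Fin n) (Fin n) ℂ) s)) (gauge (fun j => Theta θ j t) (covDeriv θ a t)) t := by
  refine hasDerivAt_matrix fun i j => ?_
  simp only [gauge_apply, covDeriv, Matrix.of_apply]
  have h1 := (((hasDerivAt_Theta hθ i t).sub (hasDerivAt_Theta hθ j t)).ofReal_comp.const_mul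
    Complex.I).cexp
  refine (h1.mul (loopAlgebra_hasDerivAt a i j t)).congr_deriv ?_
  simp only [Pi.sub_apply]
  ring

lemma norm_gauge_sub_le {θ : Fin n → ℝ → ℝ} (hθ : ∀ j, Continuous (θ j))
    (hper : ∀ j, Function.Periodic (θ j) (2 * Real.pi)) {a : loopAlgebra n}
    (h : commutatorNorm θ a ≤ 1) (s t : ℝ) :
    ‖gauge (fun j => Theta θ j t) ((a : ℝ → Matrix (Fin n) (Fin n) ℂ) t) -
      gauge (fun j => Theta θ j s) ((a : ℝ → Matrix (Fin n) (Fin n) ℂ) s)‖ ≤ |t - s| := by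
  have := Convex.norm_image_sub_le_of_norm_hasDerivWithin_le (s := Set.univ) (x := s) (y := t)
    (C := 1) (fun u _ => (hasDerivAt_gauge hθ a u).hasDerivWithinAt) (fun u _ => by
      rw [norm_gauge]; exact norm_covDeriv_le_one hθ hper h u) convex_univ trivial trivial
  simpa using this

lemma gauge_Theta_add_int {θ : Fin n → ℝ → ℝ} (hθ : ∀ j, Continuous (θ j))
    (hper : ∀ j, Function.Periodic (θ j) (2 * Real.pi)) (a : loopAlgebra n) (k : ℤ) (t : ℝ) :
    gauge (fun j => Theta θ j (2 * k * Real.pi + t))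
      ((a : ℝ → Matrix (Fin n) (Fin n) ℂ) (2 * k * Real.pi + t)) =
    gauge ((k : ℝ) • hol θ)
      (gauge (fun j => Theta θ j t) ((a : ℝ → Matrix (Fin n) (Fin n) ℂ) t)) := by
  have h1 : (a : ℝ → Matrix (Fin n) (Fin n) ℂ) (2 * k * Real.pi + t) =
      (a : ℝ → Matrix (Fin n) (Fin n) ℂ) t := by
    have := a.2.2.int_mul k t
    rwa [show t + (k : ℝ) * (2 * Real.pi) = 2 * k * Real.pi + t by ring] at this
  have h2 : ∀ j, Theta θ j (2 * k * Real.pi + t) = k * hol θ j + Theta θ j t := fun j => by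
    -- Removing its mean slope makes `Θ_j` periodic, which handles all integers `k`, negative ones
    -- included, at once.
    have hs : Function.Periodic (fun t => Theta θ j t - t / (2 * Real.pi) * hol θ j)
        (2 * Real.pi) := fun t => by
      simp only [Theta_add_two_pi hθ hper, hol]
      field_simp
      ring
    have := hs.int_mul k t
    rw [show t + (k : ℝ) * (2 * Real.pi) = 2 * k * Real.pi + t by ring] at this
    have e : (2 * k * Real.pi + t) / (2 * Real.pi) = k + t / (2 * Real.pi) := by
      field_simp
    simp only [e] at this
    linarith
  rw [gauge_gauge, h1]
  congr 2
  funext j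
  simp [h2]

lemma vectorState_apply (t : ℝ) (v : Fin n → ℂ) (a : loopAlgebra n) :
    vectorState t v a = star v ⬝ᵥ ((a : ℝ → Matrix (Fin n) (Fin n) ℂ) t *ᵥ v) := rfl

/-- The phases of the transported vector are absorbed into the observable, so the vector no longer
depends on `t`. -/
lemma vectorState_liftVec (θ : Fin n → ℝ → ℝ) (v : Fin n → ℂ) (t : ℝ) (a : loopAlgebra n) :
    vectorState t (liftVec θ v t) a = star v ⬝ᵥ
      (gauge (fun j => Theta θ j t) ((a : ℝ → Matrix (Fin n) (Fin n) ℂ) t) *ᵥ v) := by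
  have : liftVec θ v t = phase (-fun j => Theta θ j t) v := by
    funext j
    simp [liftVec, phase, mul_comm]
  rw [star_dotProduct_gauge, vectorState_apply, this]

lemma liftVec_zero (θ : Fin n → ℝ → ℝ) (v : Fin n → ℂ) : liftVec θ v 0 = v := by
  funext j
  simp [liftVec, Theta_zero]

lemma liftVec_unit (θ : Fin n → ℝ → ℝ) {v : Fin n → ℂ} (hv : star v ⬝ᵥ v = 1) (t : ℝ) :
    star (liftVec θ v t) ⬝ᵥ liftVec θ v t = 1 := by
  have : vectorState t (liftVec θ v t) 1 = 1 := by
    rw [vectorState_liftVec]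
    have : gauge (fun j => Theta θ j t) (1 : Matrix (Fin n) (Fin n) ℂ) = 1 := by
      ext i j
      rcases eq_or_ne i j with rfl | hij
      · simp [gauge_apply]
      · simp [gauge_apply, hij]
    simp [this, hv]
  simpa [vectorState_apply] using this

/-! ### Reduction to Hermitian observables and the general upper bound. -/

lemma star_dotProduct_conjTranspose_mulVec (M : Matrix (Fin n) (Fin n) ℂ) (v : Fin n → ℂ) :
    star v ⬝ᵥ Mᴴ *ᵥ v = star (star v ⬝ᵥ M *ᵥ v) := by
  rw [Matrix.star_dotProduct, Matrix.star_mulVec, Matrix.conjTranspose_conjTranspose,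
    ← Matrix.dotProduct_mulVec]

/-- The Hermitian part of `c • M`. -/
def hermPart (c : ℂ) (M : Matrix (Fin n) (Fin n) ℂ) : Matrix (Fin n) (Fin n) ℂ :=
  (2⁻¹ : ℂ) • (c • M + (c • M)ᴴ)

lemma hermPart_conjTranspose (c : ℂ) (M : Matrix (Fin n) (Fin n) ℂ) :
    (hermPart c M)ᴴ = hermPart c M := by
  simp [hermPart, Matrix.conjTranspose_smul, add_comm]

lemma hermPart_sub (c : ℂ) (M N : Matrix (Fin n) (Fin n) ℂ) :
    hermPart c (M - N) = hermPart c M - hermPart c N := by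
  simp only [hermPart, smul_sub, Matrix.conjTranspose_sub, smul_add]
  abel

lemma norm_hermPart_le {c : ℂ} (hc : ‖c‖ ≤ 1) (M : Matrix (Fin n) (Fin n) ℂ) :
    ‖hermPart c M‖ ≤ ‖M‖ := by
  have h1 : ‖c • M‖ ≤ ‖M‖ := by
    rw [norm_smul]
    exact mul_le_of_le_one_left (norm_nonneg _) hc
  have h2 : ‖(c • M)ᴴ‖ ≤ ‖M‖ := by rwa [Matrix.l2_opNorm_conjTranspose]
  have h3 : ‖(2⁻¹ : ℂ)‖ = 2⁻¹ := by norm_num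
  rw [hermPart, norm_smul, h3]
  have := norm_add_le (c • M) (c • M)ᴴ
  linarith

lemma hermPart_gauge (c : ℂ) (x : Fin n → ℝ) (M : Matrix (Fin n) (Fin n) ℂ) :
    hermPart c (gauge x M) = gauge x (hermPart c M) := by
  simp only [hermPart, map_smul, map_add, gauge_star]

lemma star_dotProduct_hermPart (c : ℂ) (M : Matrix (Fin n) (Fin n) ℂ) (v : Fin n → ℂ) :
    star v ⬝ᵥ hermPart c M *ᵥ v = ((c * (star v ⬝ᵥ M *ᵥ v)).re : ℂ) := by
  rw [hermPart, Matrix.smul_mulVec, Matrix.add_mulVec, dotProduct_smul, dotProduct_add,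
    star_dotProduct_conjTranspose_mulVec, Matrix.smul_mulVec, dotProduct_smul, smul_eq_mul,
    smul_eq_mul, Complex.star_def, Complex.re_eq_add_conj]
  ring

lemma exists_unit_mul (a : ℂ) : ∃ u : ℂ, ‖u‖ = 1 ∧ a * u = ‖a‖ := by
  rcases eq_or_ne a 0 with h0 | h0
  · exact ⟨1, by simp, by simp [h0]⟩
  · refine ⟨star a / ‖a‖, by simp [h0], ?_⟩
    have : (‖a‖ : ℂ) ≠ 0 := by simpa using h0
    rw [mul_div_assoc', Complex.star_def, Complex.mul_conj', sq, mul_div_assoc,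
      div_self this, mul_one]

/-- An upper bound of the spectral distance in terms of the values of the transported
Hermitian observables at the points `0` and `τ₀`. -/
theorem spectralDist_le {θ : Fin n → ℝ → ℝ} (hθ : ∀ j, Continuous (θ j))
    (hper : ∀ j, Function.Periodic (θ j) (2 * Real.pi)) {τ₀ : ℝ} (h0 : 0 ≤ τ₀)
    (h1 : τ₀ ≤ 2 * Real.pi) (k : ℤ) (v w : Fin n → ℂ) {C : ℝ}
    (h : ∀ B₀ B₁ : Matrix (Fin n) (Fin n) ℂ, B₀ᴴ = B₀ → B₁ᴴ = B₁ → ‖B₁ - B₀‖ ≤ τ₀ →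
      ‖gauge (hol θ) B₀ - B₁‖ ≤ 2 * Real.pi - τ₀ →
      ‖star v ⬝ᵥ B₀ *ᵥ v - star w ⬝ᵥ gauge ((k : ℝ) • hol θ) B₁ *ᵥ w‖ ≤ C) :
    spectralDist θ (vectorState 0 v)
      (vectorState (2 * k * Real.pi + τ₀) (liftVec θ w (2 * k * Real.pi + τ₀))) ≤
      ENNReal.ofReal C := by
  refine iSup₂_le fun a ha => ENNReal.ofReal_le_ofReal ?_
  have hv : vectorState 0 v = vectorState 0 (liftVec θ v 0) := by rw [liftVec_zero]
  rw [hv, vectorState_liftVec, vectorState_liftVec, gauge_Theta_add_int hθ hper]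
  set b : ℝ → Matrix (Fin n) (Fin n) ℂ := fun t =>
    gauge (fun j => Theta θ j t) ((a : ℝ → Matrix (Fin n) (Fin n) ℂ) t) with hb
  have hlip : ∀ s t, ‖b t - b s‖ ≤ |t - s| := norm_gauge_sub_le hθ hper ha
  have hb2 : b (2 * Real.pi) = gauge (hol θ) (b 0) := by
    simpa using gauge_Theta_add_int hθ hper a 1 0
  change ‖star v ⬝ᵥ b 0 *ᵥ v - star w ⬝ᵥ gauge ((k : ℝ) • hol θ) (b τ₀) *ᵥ w‖ ≤ C
  set S := star v ⬝ᵥ b 0 *ᵥ v - star w ⬝ᵥ gauge ((k : ℝ) • hol θ) (b τ₀) *ᵥ w with hS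
  -- Multiplying the observable by the phase `c` makes the gap equal to `‖S‖`. The Hermitian part
  -- then has the same gap, while its increments are no larger in norm.
  obtain ⟨c, hc, hcS⟩ := exists_unit_mul S
  rw [mul_comm] at hcS
  have key := h (hermPart c (b 0)) (hermPart c (b τ₀)) (hermPart_conjTranspose _ _)
    (hermPart_conjTranspose _ _)
    (by
      rw [← hermPart_sub]
      refine (norm_hermPart_le hc.le _).trans ((hlip _ _).trans_eq ?_)
      rw [sub_zero, abs_of_nonneg h0])
    (by
      rw [← hermPart_gauge, ← hermPart_sub, ← hb2]
      refine (norm_hermPart_le hc.le _).trans ((hlip _ _).trans_eq ?_)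
      rw [abs_of_nonneg (by linarith)])
  rw [← hermPart_gauge, star_dotProduct_hermPart, star_dotProduct_hermPart, ← Complex.ofReal_sub,
    ← Complex.sub_re, ← mul_sub, hcS, Complex.ofReal_re, Complex.norm_real, norm_norm] at key
  exact key

/-! ### Construction of observables with prescribed values and the general lower bound. -/

/-- Two prescribed values at `0` and `τ₀` are interpolated by a quasi-periodic function of
Lipschitz constant one. -/
lemma exists_lipschitz_quasiperiodic (x : Fin n → ℝ) {τ₀ : ℝ} (h0 : 0 ≤ τ₀)
    (h1 : τ₀ ≤ 2 * Real.pi) {B₀ B₁ : Matrix (Fin n) (Fin n) ℂ} (hB : ‖B₁ - B₀‖ ≤ τ₀)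
    (hB' : ‖gauge x B₀ - B₁‖ ≤ 2 * Real.pi - τ₀) :
    ∃ b : ℝ → Matrix (Fin n) (Fin n) ℂ, LipschitzWith 1 b ∧
      (∀ t, b (t + 2 * Real.pi) = gauge x (b t)) ∧ b 0 = B₀ ∧ b τ₀ = B₁ := by
  have hpi := Real.two_pi_pos
  -- `β` is the slope of the interpolation: constant on each of the two arcs of a period, and
  -- conjugated by the `m`-th power of the holonomy on the `m`-th period.
  set g₁ : ℤ → Matrix (Fin n) (Fin n) ℂ := fun m => gauge ((m : ℝ) • x) (τ₀⁻¹ • (B₁ - B₀)) with hg₁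
  set g₂ : ℤ → Matrix (Fin n) (Fin n) ℂ := fun m =>
    gauge ((m : ℝ) • x) ((2 * Real.pi - τ₀)⁻¹ • (gauge x B₀ - B₁)) with hg₂
  set β : ℝ → Matrix (Fin n) (Fin n) ℂ := fun t =>
    if t - ⌊t / (2 * Real.pi)⌋ * (2 * Real.pi) < τ₀ then g₁ ⌊t / (2 * Real.pi)⌋
    else g₂ ⌊t / (2 * Real.pi)⌋ with hβ
  have hfl : Measurable fun t : ℝ => ⌊t / (2 * Real.pi)⌋ := by fun_prop
  have hβm : StronglyMeasurable β := by
    refine StronglyMeasurable.ite (measurableSet_lt (by fun_prop) measurable_const) ?_ ?_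
    · exact (StronglyMeasurable.of_discrete (f := g₁)).comp_measurable hfl
    · exact (StronglyMeasurable.of_discrete (f := g₂)).comp_measurable hfl
  -- For an arc of length `c = 0` the convention `0⁻¹ = 0` gives slope zero, which is right since
  -- the increment is then forced to vanish.
  have hinv : ∀ {c : ℝ} {M : Matrix (Fin n) (Fin n) ℂ}, ‖M‖ ≤ c → ‖c⁻¹ • M‖ ≤ 1 := by
    intro c M hM
    have hc : 0 ≤ c := (norm_nonneg _).trans hM
    rw [norm_smul, norm_inv, Real.norm_of_nonneg hc]
    rcases hc.eq_or_lt with rfl | hc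
    · simp
    · rwa [inv_mul_le_iff₀ hc, mul_one]
  have hβ1 : ∀ t, ‖β t‖ ≤ 1 := by
    intro t
    simp only [hβ]
    split_ifs
    · simp only [hg₁, norm_gauge]
      exact hinv hB
    · simp only [hg₂, norm_gauge]
      exact hinv hB'
  have hβi : ∀ s t, IntervalIntegrable β volume s t := fun s t =>
    (intervalIntegrable_const (c := (1 : ℝ))).mono_fun hβm.aestronglyMeasurable
      (Filter.Eventually.of_forall fun u => by simpa using hβ1 u)
  have hβq : ∀ t, β (t + 2 * Real.pi) = gauge x (β t) := by
    intro t
    have e : ⌊(t + 2 * Real.pi) / (2 * Real.pi)⌋ = ⌊t / (2 * Real.pi)⌋ + 1 := by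
      rw [add_div, div_self hpi.ne', Int.floor_add_one]
    simp only [hβ, e, hg₁, hg₂]
    have e2 : t + 2 * Real.pi - ((⌊t / (2 * Real.pi)⌋ + 1 : ℤ) : ℝ) * (2 * Real.pi) =
        t - ⌊t / (2 * Real.pi)⌋ * (2 * Real.pi) := by
      push_cast
      ring
    have e3 : ((⌊t / (2 * Real.pi)⌋ + 1 : ℤ) : ℝ) • x = x + (⌊t / (2 * Real.pi)⌋ : ℝ) • x := by
      push_cast
      rw [add_smul, one_smul, add_comm]
    rw [e2, e3]
    split_ifs <;> rw [gauge_gauge]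
  have hfl0 : ∀ t ∈ Set.Ioo 0 (2 * Real.pi), ⌊t / (2 * Real.pi)⌋ = 0 := fun t ht => by
    rw [Int.floor_eq_zero_iff]
    exact ⟨by have := ht.1; positivity, (div_lt_one hpi).2 ht.2⟩
  have hI1 : ∫ t in (0 : ℝ)..τ₀, β t = B₁ - B₀ := by
    have : ∫ t in (0 : ℝ)..τ₀, β t = ∫ t in (0 : ℝ)..τ₀, τ₀⁻¹ • (B₁ - B₀) := by
      refine intervalIntegral.integral_congr_Ioo_of_le h0 fun t ht => ?_
      have := hfl0 t ⟨ht.1, ht.2.trans_le h1⟩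
      simp only [hβ, hg₁, hg₂, this]
      rw [if_pos (by simpa using ht.2)]
      simp [gauge_zero]
    rw [this, intervalIntegral.integral_const, sub_zero]
    rcases h0.eq_or_lt with rfl | h0
    · have : B₁ - B₀ = 0 := by simpa using hB
      simp [this]
    · rw [smul_smul, mul_inv_cancel₀ h0.ne', one_smul]
  have hI2 : ∫ t in τ₀..(2 * Real.pi), β t = gauge x B₀ - B₁ := by
    have : ∫ t in τ₀..(2 * Real.pi), β t =
        ∫ t in τ₀..(2 * Real.pi), (2 * Real.pi - τ₀)⁻¹ • (gauge x B₀ - B₁) := by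
      refine intervalIntegral.integral_congr_Ioo_of_le h1 fun t ht => ?_
      have := hfl0 t ⟨h0.trans_lt ht.1, ht.2⟩
      simp only [hβ, hg₁, hg₂, this]
      rw [if_neg (by simpa using ht.1.le)]
      simp [gauge_zero]
    rw [this, intervalIntegral.integral_const]
    rcases h1.eq_or_lt with rfl | h1
    · have : gauge x B₀ - B₁ = 0 := by simpa using hB'
      simp [this]
    · rw [smul_smul, mul_inv_cancel₀ (by linarith), one_smul]
  refine ⟨fun t => B₀ + ∫ s in (0 : ℝ)..t, β s, ?_, fun t => ?_, by simp, by simp [hI1]⟩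
  · refine LipschitzWith.of_dist_le_mul fun s t => ?_
    rw [dist_add_left, dist_eq_norm, intervalIntegral.integral_interval_sub_left (hβi _ _) (hβi _ _),
      Real.dist_eq]
    exact intervalIntegral.norm_integral_le_of_norm_le_const fun u _ => hβ1 u
  · have e1 : ∫ s in (0 : ℝ)..(2 * Real.pi), β s = gauge x B₀ - B₀ := by
      rw [← intervalIntegral.integral_add_adjacent_intervals (hβi 0 τ₀) (hβi τ₀ _), hI1, hI2]
      abel
    have e2 : ∫ s in (2 * Real.pi)..(t + 2 * Real.pi), β s = gauge x (∫ s in (0 : ℝ)..t, β s) := by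
      have := intervalIntegral.integral_comp_add_right (a := 0) (b := t) β (2 * Real.pi)
      rw [zero_add] at this
      rw [← this, ← ContinuousLinearMap.intervalIntegral_comp_comm _ (hβi 0 t)]
      simp only [hβq]
    change B₀ + (∫ s in (0 : ℝ)..(t + 2 * Real.pi), β s) = gauge x (B₀ + ∫ s in (0 : ℝ)..t, β s)
    rw [← intervalIntegral.integral_add_adjacent_intervals (hβi 0 (2 * Real.pi)) (hβi _ _), e1, e2,
      map_add]
    abel

/-- Quasi-periodic functions of Lipschitz constant one are uniform limits of smooth ones. -/
lemma exists_smooth_quasiperiodic (x : Fin n → ℝ) {b : ℝ → Matrix (Fin n) (Fin n) ℂ}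
    (hb : LipschitzWith 1 b) (hq : ∀ t, b (t + 2 * Real.pi) = gauge x (b t)) {ε : ℝ} (hε : 0 < ε) :
    ∃ c : ℝ → Matrix (Fin n) (Fin n) ℂ, ContDiff ℝ ∞ c ∧ LipschitzWith 1 c ∧
      (∀ t, c (t + 2 * Real.pi) = gauge x (c t)) ∧ ∀ t, ‖c t - b t‖ ≤ ε := by
  -- Convolution with this bump averages translates of `b`. It keeps the Lipschitz constant,
  -- commutes with the linear map `gauge x`, and moves `b` by at most the outer radius `ε`.
  let φ : ContDiffBump (0 : ℝ) := ⟨ε / 2, ε, by positivity, by linarith⟩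
  have hbc := hb.continuous
  have hφc : Continuous (φ.normed volume) := φ.continuous_normed
  have hint : ∀ y, Integrable fun t => φ.normed volume t • b (y - t) := fun y =>
    Continuous.integrable_of_hasCompactSupport (by fun_prop)
      (φ.hasCompactSupport_normed.smul_right)
  refine ⟨convolution (φ.normed volume) b (ContinuousLinearMap.lsmul ℝ ℝ) volume, ?_, ?_, ?_, ?_⟩
  · exact φ.hasCompactSupport_normed.contDiff_convolution_left _ φ.contDiff_normed
      hbc.locallyIntegrable
  · refine LipschitzWith.of_dist_le_mul fun s t => ?_
    simp only [convolution_def, ContinuousLinearMap.lsmul_apply]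
    rw [dist_eq_norm, ← integral_sub (hint s) (hint t)]
    refine (norm_integral_le_of_norm_le (φ.integrable_normed.mul_const (dist s t))
      (Filter.Eventually.of_forall fun u => ?_)).trans_eq ?_
    · rw [← smul_sub, norm_smul, Real.norm_of_nonneg (φ.nonneg_normed u), ← dist_eq_norm]
      refine mul_le_mul_of_nonneg_left ?_ (φ.nonneg_normed u)
      simpa using hb.dist_le_mul (s - u) (t - u)
    · rw [integral_mul_const, φ.integral_normed]
      simp
  · intro t
    simp only [convolution_def, ContinuousLinearMap.lsmul_apply]
    rw [← ContinuousLinearMap.integral_comp_comm _ (hint t)]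
    refine integral_congr_ae (Filter.Eventually.of_forall fun u => ?_)
    simp only
    rw [show t + 2 * Real.pi - u = t - u + 2 * Real.pi by ring, hq,
      ContinuousLinearMap.map_smul_of_tower]
  · intro t
    rw [← dist_eq_norm]
    refine φ.dist_normed_convolution_le hbc.aestronglyMeasurable fun u hu => ?_
    have := hb.dist_le_mul u t
    have := Metric.mem_ball.1 hu
    simp only [NNReal.coe_one, one_mul, φ] at *
    linarith

/-- A smooth quasi-periodic function of Lipschitz constant one comes from an element of the
algebra whose commutator has norm at most one. -/
lemma exists_loopAlgebra {θ : Fin n → ℝ → ℝ} (hθ : ∀ j, ContDiff ℝ ∞ (θ j))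
    (hper : ∀ j, Function.Periodic (θ j) (2 * Real.pi)) {c : ℝ → Matrix (Fin n) (Fin n) ℂ}
    (hc : ContDiff ℝ ∞ c) (hl : LipschitzWith 1 c)
    (hq : ∀ t, c (t + 2 * Real.pi) = gauge (hol θ) (c t)) :
    ∃ a : loopAlgebra n, commutatorNorm θ a ≤ 1 ∧ ∀ t,
      gauge (fun j => Theta θ j t) ((a : ℝ → Matrix (Fin n) (Fin n) ℂ) t) = c t := by
  have hθc : ∀ j, Continuous (θ j) := fun j => (hθ j).continuous
  -- Returning from the parallel frame; the holonomy in `hq` cancels the growth of `Θ` over a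
  -- period, so `a` is truly periodic.
  let a : loopAlgebra n := ⟨fun t => gauge (-fun j => Theta θ j t) (c t), by
    refine ⟨fun i j => ?_, fun t => ?_⟩
    · have h1 : ContDiff ℝ ∞ fun t => c t i j := (entryCLM i j).contDiff.comp hc
      have h2 := Theta_contDiff hθ i
      have h3 := Theta_contDiff hθ j
      have h4 : ContDiff ℝ ∞ fun t => (((-Theta θ i t) - (-Theta θ j t) : ℝ) : ℂ) :=
        Complex.ofRealCLM.contDiff.comp (h2.neg.sub h3.neg)
      simp only [gauge_apply, Pi.neg_apply]
      exact (contDiff_const.mul h4).cexp.mul h1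
    · simp only [hq, gauge_gauge, Theta_add_two_pi hθc hper]
      congr 2
      funext j
      simp [hol]⟩
  have ha : ∀ t, gauge (fun j => Theta θ j t) ((a : ℝ → Matrix (Fin n) (Fin n) ℂ) t) = c t := by
    intro t
    simp only [a, gauge_gauge, add_neg_cancel, gauge_zero]
  refine ⟨a, commutatorNorm_le_one hθc fun t => ?_, ha⟩
  have h := hasDerivAt_gauge hθc a t
  rw [funext ha] at h
  rw [← norm_gauge (fun j => Theta θ j t), ← h.deriv]
  simpa using norm_deriv_le_of_lipschitz (x₀ := t) hl

/-- A lower bound of the spectral distance in terms of the values of the transported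
observables at the points `0` and `τ₀`. -/
theorem le_spectralDist {θ : Fin n → ℝ → ℝ} (hθ : ∀ j, ContDiff ℝ ∞ (θ j))
    (hper : ∀ j, Function.Periodic (θ j) (2 * Real.pi)) {τ₀ : ℝ} (h0 : 0 ≤ τ₀)
    (h1 : τ₀ ≤ 2 * Real.pi) (k : ℤ) {v w : Fin n → ℂ} (hv : star v ⬝ᵥ v = 1)
    (hw : star w ⬝ᵥ w = 1) {B₀ B₁ : Matrix (Fin n) (Fin n) ℂ} (hB : ‖B₁ - B₀‖ ≤ τ₀)
    (hB' : ‖gauge (hol θ) B₀ - B₁‖ ≤ 2 * Real.pi - τ₀) :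
    ENNReal.ofReal ‖star v ⬝ᵥ B₀ *ᵥ v - star w ⬝ᵥ gauge ((k : ℝ) • hol θ) B₁ *ᵥ w‖ ≤
      spectralDist θ (vectorState 0 v)
        (vectorState (2 * k * Real.pi + τ₀) (liftVec θ w (2 * k * Real.pi + τ₀))) := by
  obtain ⟨b, hbl, hbq, rfl, rfl⟩ := exists_lipschitz_quasiperiodic (hol θ) h0 h1 hB hB'
  set p := vectorState 0 v
  set q := vectorState (2 * k * Real.pi + τ₀) (liftVec θ w (2 * k * Real.pi + τ₀))
  rcases eq_or_ne (spectralDist θ p q) ⊤ with htop | htop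
  · rw [htop]
    exact le_top
  rw [ENNReal.ofReal_le_iff_le_toReal htop]
  refine le_of_forall_pos_le_add fun ε hε => ?_
  -- An error `ε / 2` is allowed at each of the two evaluation points.
  obtain ⟨c, hcs, hcl, hcq, hcb⟩ := exists_smooth_quasiperiodic (hol θ) hbl hbq (half_pos hε)
  obtain ⟨a, ha, hac⟩ := exists_loopAlgebra hθ hper hcs hcl hcq
  have hle : ENNReal.ofReal ‖p a - q a‖ ≤ spectralDist θ p q :=
    le_iSup₂ (f := fun (a : loopAlgebra n) (_ : commutatorNorm θ a ≤ 1) =>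
      ENNReal.ofReal ‖p a - q a‖) a ha
  rw [ENNReal.ofReal_le_iff_le_toReal htop] at hle
  have hp : p a = star v ⬝ᵥ c 0 *ᵥ v := by
    rw [← hac, ← vectorState_liftVec, liftVec_zero]
  have hq : q a = star w ⬝ᵥ gauge ((k : ℝ) • hol θ) (c τ₀) *ᵥ w := by
    rw [vectorState_liftVec, gauge_Theta_add_int (fun j => (hθ j).continuous) hper, hac]
  have e : star v ⬝ᵥ b 0 *ᵥ v - star w ⬝ᵥ gauge ((k : ℝ) • hol θ) (b τ₀) *ᵥ w =
      (p a - q a) - star v ⬝ᵥ (c 0 - b 0) *ᵥ v +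
        star w ⬝ᵥ gauge ((k : ℝ) • hol θ) (c τ₀ - b τ₀) *ᵥ w := by
    rw [hp, hq, map_sub, Matrix.sub_mulVec, Matrix.sub_mulVec, dotProduct_sub, dotProduct_sub]
    ring
  rw [e]
  have e1 := (norm_star_dotProduct_mulVec_le (c 0 - b 0) hv).trans (hcb 0)
  have e2 := norm_star_dotProduct_mulVec_le (gauge ((k : ℝ) • hol θ) (c τ₀ - b τ₀)) hw
  rw [norm_gauge] at e2
  have e2 := e2.trans (hcb τ₀)
  refine (norm_add_le _ _).trans ?_
  have := norm_sub_le (p a - q a) (star v ⬝ᵥ (c 0 - b 0) *ᵥ v)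
  linarith

/-! ### Horizontal curves. -/

/-- The products `e^{iΘ_j(γ)} V_j` have zero derivative along a horizontal curve, and their constant
values are the components of `U`. -/
lemma IsHorizontal.exists_liftVec {θ : Fin n → ℝ → ℝ} (hθ : ∀ j, Continuous (θ j)) {γ : ℝ → ℝ}
    {V : ℝ → Fin n → ℂ} (h : IsHorizontal θ γ V) : ∃ U, ∀ t, V t = liftVec θ U (γ t) := by
  have hd : ∀ j t, HasDerivAt (fun t => Complex.exp (Complex.I * (Theta θ j (γ t) : ℂ)) * V t j)
      0 t := by
    intro j t
    have h1 := (hasDerivAt_pi.1 (h.2 t)) j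
    have h2 : HasDerivAt γ (deriv γ t) t :=
      (h.1.differentiable (by simp)).differentiableAt.hasDerivAt
    have h3 := ((((hasDerivAt_Theta hθ j (γ t)).comp t h2).ofReal_comp.const_mul
      Complex.I).cexp).mul h1
    refine h3.congr_deriv ?_
    simp only [gaugeField, Pi.neg_apply, Pi.smul_apply, Matrix.mulVec_diagonal, smul_eq_mul,
      Function.comp_apply]
    push_cast
    ring
  refine ⟨fun j => Complex.exp (Complex.I * (Theta θ j (γ 0) : ℂ)) * V 0 j, fun t => ?_⟩
  funext j
  have := is_const_of_deriv_eq_zero (fun t => (hd j t).differentiableAt) (fun t => (hd j t).deriv)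
    0 t
  simp only [liftVec]
  rw [this, mul_right_comm, ← Complex.exp_add, add_neg_cancel, Complex.exp_zero, one_mul]

/-- Both endpoints are transports of one vector `U`, so the Lipschitz bound controls the gap. Since
`IsHorizontal` does not normalise `V`, the factor `‖U‖²` remains. -/
lemma spectralDist_lt_top_of_horizontalDist {θ : Fin n → ℝ → ℝ} (hθ : ∀ j, Continuous (θ j))
    (hper : ∀ j, Function.Periodic (θ j) (2 * Real.pi)) {p q : loopAlgebra n →ₗ[ℂ] ℂ}
    (h : horizontalDist θ p q < ⊤) : spectralDist θ p q < ⊤ := by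
  simp only [horizontalDist, iInf_lt_iff] at h
  obtain ⟨γ, V, hV, rfl, rfl, -⟩ := h
  obtain ⟨U, hU⟩ := hV.exists_liftVec hθ
  refine lt_of_le_of_lt (iSup₂_le fun a ha => ENNReal.ofReal_le_ofReal ?_)
    (ENNReal.ofReal_lt_top (r := |γ 0 - γ 1| * ‖WithLp.toLp 2 U‖ ^ 2))
  rw [hU, hU, vectorState_liftVec, vectorState_liftVec, ← dotProduct_sub, ← Matrix.sub_mulVec]
  refine (norm_star_dotProduct_mulVec_le_mul _ _).trans ?_
  gcongr
  exact norm_gauge_sub_le hθ hper ha _ _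

lemma horizontalDist_liftVec_lt_top {θ : Fin n → ℝ → ℝ} (hθ : ∀ j, Continuous (θ j))
    (U : Fin n → ℂ) (τ : ℝ) :
    horizontalDist θ (vectorState 0 U) (vectorState τ (liftVec θ U τ)) < ⊤ := by
  have hγ : ∀ t, HasDerivAt (fun t : ℝ => τ * t) τ t := fun t => by
    simpa using (hasDerivAt_id t).const_mul τ
  refine lt_of_le_of_lt (iInf_le_of_le (fun t => τ * t) (iInf_le_of_le
    (fun t => liftVec θ U (τ * t)) (iInf_le_of_le ⟨by fun_prop, fun t => ?_⟩
      (iInf_le_of_le (by simp [liftVec_zero]) (iInf_le_of_le (by simp) le_rfl)))))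
    ENNReal.ofReal_lt_top
  refine hasDerivAt_pi.2 fun j => ?_
  have h1 := ((((hasDerivAt_Theta hθ j (τ * t)).comp t (hγ t)).ofReal_comp.const_mul
    Complex.I).neg.cexp).const_mul (U j)
  refine h1.congr_deriv ?_
  simp only [gaugeField, Pi.neg_apply, Pi.smul_apply, Matrix.mulVec_diagonal, smul_eq_mul,
    Function.comp_apply, (hγ t).deriv, liftVec]
  push_cast
  ring

/-! ### The operator norm of Hermitian `2 × 2` matrices. -/

/-- The Hermitian matrix with trace `2T`, difference of the diagonal entries `2D` and
off-diagonal entry `g`. -/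
def herm2 (T D : ℝ) (g : ℂ) : Matrix (Fin 2) (Fin 2) ℂ := !![(T : ℂ) + D, g; star g, (T : ℂ) - D]

lemma herm2_conjTranspose (T D : ℝ) (g : ℂ) : (herm2 T D g)ᴴ = herm2 T D g := by
  ext i j
  fin_cases i <;> fin_cases j <;> simp [herm2]

lemma eq_herm2 {M : Matrix (Fin 2) (Fin 2) ℂ} (h : Mᴴ = M) :
    M = herm2 (((M 0 0).re + (M 1 1).re) / 2) (((M 0 0).re - (M 1 1).re) / 2) (M 0 1) := by
  have h0 : ∀ i, M i i = ((M i i).re : ℂ) := fun i =>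
    (Complex.conj_eq_iff_re.1 (by simpa using congr_fun (congr_fun h i) i)).symm
  have h1 : star (M 0 1) = M 1 0 := by simpa using congr_fun (congr_fun h 1) 0
  ext i j
  fin_cases i <;> fin_cases j
  · simp only [herm2, Fin.zero_eta, Matrix.of_apply, Matrix.cons_val_zero, Matrix.cons_val']
    conv_lhs => rw [h0 0]
    push_cast
    ring
  · simp [herm2]
  · simp [herm2, ← h1]
  · simp only [herm2, Fin.mk_one, Matrix.of_apply, Matrix.cons_val_one, Matrix.cons_val']
    conv_lhs => rw [h0 1]
    push_cast
    ring

lemma herm2_eq_add (T D : ℝ) (g : ℂ) :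
    herm2 T D g = (T : ℂ) • (1 : Matrix (Fin 2) (Fin 2) ℂ) + herm2 0 D g := by
  ext i j
  fin_cases i <;> fin_cases j <;> simp [herm2, sub_eq_add_neg]

lemma herm2_mul_self (D : ℝ) (g : ℂ) :
    herm2 0 D g * herm2 0 D g =
      ((D ^ 2 + ‖g‖ ^ 2 : ℝ) : ℂ) • (1 : Matrix (Fin 2) (Fin 2) ℂ) := by
  have h1 : g * star g = (‖g‖ : ℂ) ^ 2 := Complex.mul_conj' g
  ext i j
  fin_cases i <;> fin_cases j <;>
    simp only [herm2, Matrix.mul_apply, Fin.sum_univ_two, Fin.zero_eta, Fin.mk_one, Matrix.of_apply,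
      Matrix.cons_val', Matrix.cons_val_zero, Matrix.cons_val_one, Matrix.smul_apply, smul_eq_mul,
      Matrix.one_apply, Complex.ofReal_zero, Complex.ofReal_add, Complex.ofReal_pow,
      Matrix.cons_val_fin_one]
  · simp only [if_true]
    linear_combination h1
  · simp only [zero_ne_one, if_false]
    ring
  · simp only [one_ne_zero, if_false]
    ring
  · simp only [if_true]
    linear_combination h1

lemma norm_traceless (D : ℝ) (g : ℂ) : ‖herm2 0 D g‖ = √(D ^ 2 + ‖g‖ ^ 2) := by
  have h : ‖herm2 0 D g‖ * ‖herm2 0 D g‖ = D ^ 2 + ‖g‖ ^ 2 := by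
    rw [← Matrix.l2_opNorm_conjTranspose_mul_self, herm2_conjTranspose, herm2_mul_self, norm_smul,
      norm_one, mul_one, Complex.norm_real, Real.norm_of_nonneg (by positivity)]
  rw [← h, Real.sqrt_mul_self (norm_nonneg _)]

/-- The eigenvalues are `T ± √(D² + |g|²)`. The lower bound uses a matrix `E` whose columns lie in
the eigenspace of the eigenvalue of larger modulus. -/
lemma norm_herm2 (T D : ℝ) (g : ℂ) : ‖herm2 T D g‖ = |T| + √(D ^ 2 + ‖g‖ ^ 2) := by
  refine le_antisymm ?_ ?_
  · rw [herm2_eq_add]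
    refine (norm_add_le _ _).trans_eq ?_
    rw [norm_traceless, norm_smul, norm_one, mul_one, Complex.norm_real, Real.norm_eq_abs]
  · set ρ := √(D ^ 2 + ‖g‖ ^ 2) with hρ
    have hρ0 : 0 ≤ ρ := Real.sqrt_nonneg _
    have hρ2 : ρ ^ 2 = D ^ 2 + ‖g‖ ^ 2 := Real.sq_sqrt (by positivity)
    -- `r = ±ρ` has the sign of `T`. As the traceless part squares to `r²`, its sum `E` with `r`
    -- satisfies `herm2 T D g * E = (T + r) E`.
    obtain ⟨r, hr, hTr⟩ : ∃ r : ℝ, r ^ 2 = ρ ^ 2 ∧ |T + r| = |T| + ρ := by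
      rcases le_total 0 T with hT | hT
      · exact ⟨ρ, rfl, by rw [abs_of_nonneg hT, abs_of_nonneg (by linarith)]⟩
      · exact ⟨-ρ, by ring, by rw [abs_of_nonpos hT, abs_of_nonpos (by linarith)]; ring⟩
    set E := herm2 r D g with hE
    have hmul : herm2 T D g * E = ((T + r : ℝ) : ℂ) • E := by
      rw [hE, herm2_eq_add T, herm2_eq_add r, add_mul, mul_add, mul_add, herm2_mul_self, ← hρ2, ← hr]
      simp only [smul_mul_assoc, one_mul, mul_smul_comm, mul_one]
      push_cast
      module
    have hn : (|T| + ρ) * ‖E‖ ≤ ‖herm2 T D g‖ * ‖E‖ := by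
      rw [← hTr, ← Real.norm_eq_abs, ← Complex.norm_real, ← norm_smul, ← hmul]
      exact Matrix.l2_opNorm_mul _ _
    rcases eq_or_ne E 0 with h0 | h0
    · have e0 : (r : ℂ) + D = 0 := by simpa [hE, herm2] using congr_fun (congr_fun h0 0) 0
      have e1 : (r : ℂ) - D = 0 := by simpa [hE, herm2] using congr_fun (congr_fun h0 1) 1
      have e2 : r = 0 := by
        have : (r : ℂ) = 0 := by linear_combination (e0 + e1) / 2
        exact_mod_cast this
      have e3 : ρ = 0 := by
        rw [e2] at hr
        nlinarith
      have e4 : D = 0 ∧ g = 0 := by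
        rw [e3] at hρ2
        constructor
        · nlinarith [sq_nonneg D, sq_nonneg ‖g‖]
        · rw [← norm_eq_zero]
          nlinarith [sq_nonneg D, sq_nonneg ‖g‖]
      have e5 : herm2 T D g = (T : ℂ) • (1 : Matrix (Fin 2) (Fin 2) ℂ) := by
        rw [herm2_eq_add, e4.1, e4.2]
        ext i j
        fin_cases i <;> fin_cases j <;> simp [herm2]
      rw [e5, e3, norm_smul, norm_one, Complex.norm_real, Real.norm_eq_abs, mul_one, add_zero]
    · exact le_of_mul_le_mul_right hn (norm_pos_iff.2 h0)

/-- This form separates the diagonal from the off-diagonal entry: the first condition becomes the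
triangle, the second the square roots of `H`. -/
lemma norm_herm2_le_iff {T D c : ℝ} {g : ℂ} :
    ‖herm2 T D g‖ ≤ c ↔ |T| + |D| ≤ c ∧ ‖g‖ ≤ √((c - |T|) ^ 2 - D ^ 2) := by
  rw [norm_herm2]
  constructor
  · intro h
    have h1 : √(D ^ 2 + ‖g‖ ^ 2) ≤ c - |T| := by linarith
    have h2 : D ^ 2 + ‖g‖ ^ 2 ≤ (c - |T|) ^ 2 := (Real.sqrt_le_left
      ((Real.sqrt_nonneg _).trans h1)).1 h1
    refine ⟨?_, Real.le_sqrt_of_sq_le (by linarith)⟩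
    have := Real.abs_le_sqrt (x := D) (y := D ^ 2 + ‖g‖ ^ 2) (by nlinarith [sq_nonneg ‖g‖])
    linarith
  · rintro ⟨h1, h2⟩
    have h3 : D ^ 2 ≤ (c - |T|) ^ 2 := by
      rw [← sq_abs D]
      exact pow_le_pow_left₀ (abs_nonneg D) (by linarith) 2
    have h4 := (Real.le_sqrt (norm_nonneg g) (by linarith)).1 h2
    have := Real.sqrt_le_sqrt (x := D ^ 2 + ‖g‖ ^ 2) (y := (c - |T|) ^ 2) (by linarith)
    rw [Real.sqrt_sq (by linarith [abs_nonneg D])] at this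
    linarith

/-! ### The gap between two states of the torus. -/

lemma unit_sum_sq {v : Fin 2 → ℂ} (hv : star v ⬝ᵥ v = 1) : ‖v 0‖ ^ 2 + ‖v 1‖ ^ 2 = 1 := by
  rw [star_dotProduct_self_eq, Fin.sum_univ_two] at hv
  exact_mod_cast hv

lemma unit_iff {v : Fin 2 → ℂ} : star v ⬝ᵥ v = 1 ↔ ‖v 0‖ ^ 2 + ‖v 1‖ ^ 2 = 1 := by
  rw [star_dotProduct_self_eq, Fin.sum_univ_two]
  norm_cast

lemma norm_exp_I_mul (x : ℝ) : ‖Complex.exp (Complex.I * (x : ℂ))‖ = 1 := by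
  rw [mul_comm, Complex.norm_exp_ofReal_mul_I]

lemma rotate_unit {v : Fin 2 → ℂ} (hv : star v ⬝ᵥ v = 1) (φ : ℝ) :
    star (rotate φ v) ⬝ᵥ rotate φ v = 1 := by
  rw [unit_iff] at *
  simpa [rotate, norm_exp_I_mul] using hv

lemma rotate_liftVec {θ : Fin 2 → ℝ → ℝ} (v : Fin 2 → ℂ) (φ t : ℝ) :
    rotate φ (liftVec θ v t) = liftVec θ (rotate φ v) t := by
  funext j
  fin_cases j <;> simp [rotate, liftVec, mul_assoc]

lemma radius_eq {v : Fin 2 → ℂ} (hv : star v ⬝ᵥ v = 1) :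
    radius v = 2 * ‖star (v 0) * v 1‖ := by
  have h := unit_sum_sq hv
  have e : 1 - altitude v ^ 2 = (2 * (‖v 0‖ * ‖v 1‖)) ^ 2 := by
    rw [altitude]
    linear_combination (-(1 + (‖v 0‖ ^ 2 + ‖v 1‖ ^ 2))) * h
  rw [norm_mul, norm_star, radius, e, Real.sqrt_sq (by positivity)]

/-- The difference of two Hermitian observables in the states `v` and `rotate φ v`. -/
lemma state_sub {v : Fin 2 → ℂ} (hv : star v ⬝ᵥ v = 1) (φ k : ℝ) (x : Fin 2 → ℝ)
    {B₀ B₁ : Matrix (Fin 2) (Fin 2) ℂ} (h₀ : B₀ᴴ = B₀) (h₁ : B₁ᴴ = B₁) {T D : ℝ} {g : ℂ}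
    (hB : B₁ - B₀ = herm2 T D g) :
    star v ⬝ᵥ B₀ *ᵥ v - star (rotate φ v) ⬝ᵥ gauge (k • x) B₁ *ᵥ rotate φ v =
      ((-(T + altitude v * D + 2 * (star (v 0) * v 1 *
        (Complex.exp (Complex.I * ((φ + k * (x 0 - x 1) : ℝ) : ℂ)) * B₁ 0 1 - B₀ 0 1)).re) : ℝ) : ℂ)
    := by
  have hn : (‖v 0‖ : ℂ) ^ 2 + (‖v 1‖ : ℂ) ^ 2 = 1 := by exact_mod_cast unit_sum_sq hv
  have e00 : B₁ 0 0 = B₀ 0 0 + (T + D) := by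
    have := congr_fun (congr_fun hB 0) 0
    simp only [Matrix.sub_apply, herm2, Matrix.of_apply, Matrix.cons_val_zero,
      Matrix.cons_val'] at this
    linear_combination this
  have e11 : B₁ 1 1 = B₀ 1 1 + (T - D) := by
    have := congr_fun (congr_fun hB 1) 1
    simp only [Matrix.sub_apply, herm2, Matrix.of_apply, Matrix.cons_val_one, Matrix.cons_val',
      Matrix.cons_val_fin_one] at this
    linear_combination this
  have e10 : B₁ 1 0 = star (B₁ 0 1) := by simpa using (congr_fun (congr_fun h₁ 1) 0).symm
  have e10' : B₀ 1 0 = star (B₀ 0 1) := by simpa using (congr_fun (congr_fun h₀ 1) 0).symm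
  have m0 : star (v 0) * v 0 = (‖v 0‖ : ℂ) ^ 2 := Complex.conj_mul' _
  have m1 : star (v 1) * v 1 = (‖v 1‖ : ℂ) ^ 2 := Complex.conj_mul' _
  set c := Complex.exp (Complex.I * ((φ + k * (x 0 - x 1) : ℝ) : ℂ)) with hc
  have hc1 : Complex.exp (Complex.I * (φ : ℂ)) *
      Complex.exp (Complex.I * (((k • x) 0 - (k • x) 1 : ℝ) : ℂ)) = c := by
    rw [hc, ← Complex.exp_add]
    congr 1
    simp only [Pi.smul_apply, smul_eq_mul]
    push_cast
    ring
  have hc2 : star (Complex.exp (Complex.I * (φ : ℂ))) *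
      Complex.exp (Complex.I * (((k • x) 1 - (k • x) 0 : ℝ) : ℂ)) = star c := by
    rw [← hc1, star_mul', Complex.star_def, ← Complex.exp_conj, ← Complex.exp_conj]
    congr 2
    simp only [map_mul, Complex.conj_I, Complex.conj_ofReal]
    push_cast
    ring
  have hf : star (Complex.exp (Complex.I * (φ : ℂ))) * Complex.exp (Complex.I * (φ : ℂ)) = 1 := by
    rw [Complex.star_def, Complex.conj_mul', norm_exp_I_mul]
    simp
  have L : star v ⬝ᵥ B₀ *ᵥ v = (‖v 0‖ : ℂ) ^ 2 * B₀ 0 0 + (‖v 1‖ : ℂ) ^ 2 * B₀ 1 1 +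
      (star (v 0) * v 1 * B₀ 0 1 + star (star (v 0) * v 1 * B₀ 0 1)) := by
    simp only [dotProduct, Matrix.mulVec, Fin.sum_univ_two, Pi.star_apply, e10', star_mul', star_star]
    linear_combination B₀ 0 0 * m0 + B₀ 1 1 * m1
  have L' : star (rotate φ v) ⬝ᵥ gauge (k • x) B₁ *ᵥ rotate φ v =
      (‖v 0‖ : ℂ) ^ 2 * B₁ 0 0 + (‖v 1‖ : ℂ) ^ 2 * B₁ 1 1 +
      (star (v 0) * v 1 * (c * B₁ 0 1) + star (star (v 0) * v 1 * (c * B₁ 0 1))) := by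
    simp only [dotProduct, Matrix.mulVec, Fin.sum_univ_two, Pi.star_apply, gauge_apply, e10,
      star_mul', star_star, rotate, Matrix.cons_val_zero, Matrix.cons_val_one, sub_self,
      Complex.ofReal_zero, mul_zero, Complex.exp_zero, one_mul]
    linear_combination B₁ 0 0 * m0 + B₁ 1 1 * m1 + star (v 1) * v 1 * B₁ 1 1 * hf +
      star (v 0) * v 1 * B₁ 0 1 * hc1 + v 0 * star (v 1) * star (B₁ 0 1) * hc2
  rw [L, L', Complex.star_def, Complex.add_conj, Complex.add_conj, e00, e11]
  simp only [mul_sub, Complex.sub_re, altitude]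
  push_cast
  linear_combination (-(T : ℂ)) * hn

/-- The holonomy phase between the two directions. -/
lemma hol_sub (θ : Fin 2 → ℝ → ℝ) : hol θ 0 - hol θ 1 = 2 * Real.pi * omega θ := by
  have := Real.pi_pos
  simp only [hol, omega]
  field_simp

lemma norm_exp_sub_one (x : ℝ) :
    ‖Complex.exp (Complex.I * (x : ℂ)) - 1‖ = 2 * |Real.sin (x / 2)| := by
  rw [Complex.norm_exp_I_mul_ofReal_sub_one]
  simp

lemma far_iff_exp (θ : Fin 2 → ℝ → ℝ) :
    Far θ 0 1 ↔ Complex.exp (Complex.I * ((2 * Real.pi * omega θ : ℝ) : ℂ)) = 1 := by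
  rw [Complex.exp_eq_one_iff, ← hol_sub]
  refine exists_congr fun m => ?_
  simp only [hol]
  rw [show (m : ℂ) * (2 * Real.pi * Complex.I) = Complex.I * ((2 * Real.pi * m : ℝ) : ℂ) by
    push_cast; ring, mul_right_inj' Complex.I_ne_zero, Complex.ofReal_inj, sub_eq_iff_eq_add']

lemma gauge_apply_self {n : ℕ} (x : Fin n → ℝ) (M : Matrix (Fin n) (Fin n) ℂ) (i : Fin n) :
    gauge x M i i = M i i := by
  simp [gauge_apply]

/-! ### Nontrivial holonomy: the distance as a maximum of `H`. -/

section NontrivialHolonomy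

variable {θ : Fin 2 → ℝ → ℝ}

/-- The combination of increments of the off-diagonal entry of an observable which is seen by the
two states. -/
lemma combination_eq (hfar : ¬ Far θ 0 1) (φ k : ℝ) (β₀ β₁ : ℂ) :
    Complex.exp (Complex.I * ((φ + k * (hol θ 0 - hol θ 1) : ℝ) : ℂ)) * β₁ - β₀ =
    (Complex.exp (Complex.I * ((φ + (k + 1) * (hol θ 0 - hol θ 1) : ℝ) : ℂ)) - 1) /
      (Complex.exp (Complex.I * ((hol θ 0 - hol θ 1 : ℝ) : ℂ)) - 1) * (β₁ - β₀) +
    (Complex.exp (Complex.I * ((φ + k * (hol θ 0 - hol θ 1) : ℝ) : ℂ)) - 1) /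
      (Complex.exp (Complex.I * ((hol θ 0 - hol θ 1 : ℝ) : ℂ)) - 1) *
      (Complex.exp (Complex.I * ((hol θ 0 - hol θ 1 : ℝ) : ℂ)) * β₀ - β₁) := by
  have h : Complex.exp (Complex.I * ((hol θ 0 - hol θ 1 : ℝ) : ℂ)) - 1 ≠ 0 := by
    rwa [sub_ne_zero, Ne, hol_sub, ← far_iff_exp]
  -- With `η` the holonomy phase and `c = e^{i(φ + k(hol₀ - hol₁))}`, the claim is `(cη - 1)(β₁ -
  -- β₀) + (c - 1)(ηβ₀ - β₁) = (η - 1)(cβ₁ - β₀)`.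
  have e : Complex.exp (Complex.I * ((φ + (k + 1) * (hol θ 0 - hol θ 1) : ℝ) : ℂ)) =
      Complex.exp (Complex.I * ((φ + k * (hol θ 0 - hol θ 1) : ℝ) : ℂ)) *
        Complex.exp (Complex.I * ((hol θ 0 - hol θ 1 : ℝ) : ℂ)) := by
    rw [← Complex.exp_add]
    congr 1
    push_cast
    ring
  rw [e]
  field_simp
  ring

/-- The origin of `W`: a ratio of two chords, each of length `|e^{ix} - 1| = 2|sin (x/2)|`. -/
lemma norm_coefficient (φ : ℝ) (k : ℤ) :
    ‖(Complex.exp (Complex.I * ((φ + k * (hol θ 0 - hol θ 1) : ℝ) : ℂ)) - 1) /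
      (Complex.exp (Complex.I * ((hol θ 0 - hol θ 1 : ℝ) : ℂ)) - 1)‖ = W θ φ k := by
  rw [norm_div, norm_exp_sub_one, norm_exp_sub_one, mul_div_mul_left _ _ two_ne_zero, W, hol_sub]
  congr 4 <;> ring_nf

lemma triangle_isCompact {s : ℝ} (hs : s = 1 ∨ s = -1) (τ₀ : ℝ) : IsCompact (triangle s τ₀) := by
  refine Metric.isCompact_of_isClosed_isBounded ?_ ?_
  · have c1 : Continuous fun x : ℝ × ℝ => s * x.2 := by fun_prop
    have c2 : Continuous fun x : ℝ × ℝ => x.1 + s * x.2 := by fun_prop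
    exact (isClosed_le continuous_const continuous_fst).inter
      ((isClosed_le continuous_const c1).inter (isClosed_le c2 continuous_const))
  · refine (Metric.isBounded_Icc (-(|τ₀|), -(|τ₀|)) (|τ₀|, |τ₀|)).subset ?_
    rintro ⟨T, D⟩ ⟨h1, h2, h3⟩
    simp only at h1 h2 h3
    have h4 : T + s * D ≤ |τ₀| := h3.trans ((min_le_left _ _).trans (le_abs_self _))
    rcases hs with rfl | rfl <;>
      exact ⟨⟨by simp only; linarith [abs_nonneg τ₀], by simp only; linarith [abs_nonneg τ₀]⟩,
        ⟨by simp only; linarith, by simp only; linarith [abs_nonneg τ₀]⟩⟩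

lemma continuous_H (V : Fin 2 → ℂ) (k : ℤ) (τ₀ φ : ℝ) : Continuous (H θ V k τ₀ φ) := by
  unfold H
  fun_prop

/-- Each term of the gap is bounded by its modulus. Replacing `(T, D)` by `(|T|, s|D|)` keeps the
constraints, lands in the triangle, and makes `T + zD` largest because `s` is the sign of `z`. -/
lemma spectralDist_torusState_le (hθ : ∀ j, ContDiff ℝ ∞ (θ j))
    (hper : ∀ j, Function.Periodic (θ j) (2 * Real.pi)) {V : Fin 2 → ℂ} (hV : star V ⬝ᵥ V = 1)
    (hfar : ¬ Far θ 0 1) (k : ℤ) {τ₀ φ : ℝ}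
    (h0 : 0 ≤ τ₀) (h1 : τ₀ ≤ 2 * Real.pi) {s : ℝ} (hs : s = 1 ∨ s = -1) (hsz : 0 ≤ s * altitude V)
    {M : ℝ} (hM : ∀ x ∈ triangle s τ₀, H θ V k τ₀ φ x ≤ M) :
    spectralDist θ (vectorState 0 V) (torusState θ V k τ₀ φ) ≤ ENNReal.ofReal M := by
  rw [torusState, rotate_liftVec]
  refine spectralDist_le (fun j => (hθ j).continuous) hper h0 h1 k _ _ fun B₀ B₁ hB₀ hB₁ hX hY => ?_
  have eX := eq_herm2 (M := B₁ - B₀) (by rw [Matrix.conjTranspose_sub, hB₀, hB₁])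
  have eY := eq_herm2 (M := gauge (hol θ) B₀ - B₁)
    (by rw [Matrix.conjTranspose_sub, ← gauge_star, hB₀, hB₁])
  simp only [Matrix.sub_apply, gauge_apply_self, gauge_apply] at eX eY
  set g := B₁ 0 1 - B₀ 0 1 with hg
  set g' := Complex.exp (Complex.I * ((hol θ 0 - hol θ 1 : ℝ) : ℂ)) * B₀ 0 1 - B₁ 0 1 with hg'
  set T := ((B₁ 0 0 - B₀ 0 0).re + (B₁ 1 1 - B₀ 1 1).re) / 2 with hT
  set D := ((B₁ 0 0 - B₀ 0 0).re - (B₁ 1 1 - B₀ 1 1).re) / 2 with hD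
  have eT : ((B₀ 0 0 - B₁ 0 0).re + (B₀ 1 1 - B₁ 1 1).re) / 2 = -T := by
    simp only [hT, Complex.sub_re]
    ring
  have eD : ((B₀ 0 0 - B₁ 0 0).re - (B₀ 1 1 - B₁ 1 1).re) / 2 = -D := by
    simp only [hD, Complex.sub_re]
    ring
  rw [eT, eD] at eY
  rw [state_sub hV φ k (hol θ) hB₀ hB₁ eX, combination_eq hfar, ← hg, ← hg']
  rw [eX, norm_herm2_le_iff] at hX
  rw [eY, norm_herm2_le_iff, abs_neg, abs_neg, neg_sq] at hY
  have hmem : (|T|, s * |D|) ∈ triangle s τ₀ := by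
    have e : s * (s * |D|) = |D| := by rcases hs with rfl | rfl <;> ring
    refine ⟨abs_nonneg T, ?_, ?_⟩ <;> simp only [e]
    · exact abs_nonneg D
    · exact le_min hX.1 hY.1
  refine le_trans ?_ (hM _ hmem)
  have hz : |altitude V * D| ≤ altitude V * (s * |D|) := by
    rw [abs_mul]
    have : |altitude V| = s * altitude V := by
      rcases hs with rfl | rfl
      · rw [one_mul, abs_of_nonneg (by linarith)]
      · rw [abs_of_nonpos (by linarith)]
        ring
    rw [this]
    exact le_of_eq (by ring)
  have hD2 : (s * |D|) ^ 2 = D ^ 2 := by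
    rw [mul_pow, sq_abs]
    rcases hs with rfl | rfl <;> ring
  rw [Complex.norm_real, Real.norm_eq_abs, abs_neg, ← Int.cast_one (R := ℝ), ← Int.cast_add, H, hD2,
    radius_eq hV, mul_add]
  simp only
  set κ := (Complex.exp (Complex.I * ((φ + ((k + 1 : ℤ) : ℝ) * (hol θ 0 - hol θ 1) : ℝ) : ℂ)) - 1) /
    (Complex.exp (Complex.I * ((hol θ 0 - hol θ 1 : ℝ) : ℂ)) - 1) with hκ
  set κ' := (Complex.exp (Complex.I * ((φ + k * (hol θ 0 - hol θ 1) : ℝ) : ℂ)) - 1) /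
    (Complex.exp (Complex.I * ((hol θ 0 - hol θ 1 : ℝ) : ℂ)) - 1) with hκ'
  rw [← norm_coefficient φ (k + 1), ← norm_coefficient φ k, ← hκ, ← hκ']
  set z := star (V 0) * V 1
  have b1 : |(z * (κ * g)).re| ≤ ‖z‖ * ‖κ‖ * √((τ₀ - |T|) ^ 2 - D ^ 2) := by
    refine (Complex.abs_re_le_norm _).trans ?_
    rw [norm_mul z, norm_mul κ, ← mul_assoc]
    exact mul_le_mul_of_nonneg_left hX.2 (by positivity)
  have b2 : |(z * (κ' * g')).re| ≤ ‖z‖ * ‖κ'‖ * √((2 * Real.pi - τ₀ - |T|) ^ 2 - D ^ 2) := by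
    refine (Complex.abs_re_le_norm _).trans ?_
    rw [norm_mul z, norm_mul κ', ← mul_assoc]
    exact mul_le_mul_of_nonneg_left hY.2 (by positivity)
  rw [Complex.add_re]
  rw [abs_le] at *
  have := neg_abs_le T
  have := le_abs_self T
  constructor <;> linarith

/-- The estimates of the upper bound are all attained: `g` and `g'` get the largest admissible
moduli and the phases that make both contributions nonnegative. -/
lemma ofReal_H_le_spectralDist (hθ : ∀ j, ContDiff ℝ ∞ (θ j))
    (hper : ∀ j, Function.Periodic (θ j) (2 * Real.pi)) {V : Fin 2 → ℂ} (hV : star V ⬝ᵥ V = 1)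
    (hfar : ¬ Far θ 0 1) (k : ℤ) {τ₀ φ : ℝ}
    (h0 : 0 ≤ τ₀) (h1 : τ₀ ≤ 2 * Real.pi) {s : ℝ} (hs : s = 1 ∨ s = -1) {x : ℝ × ℝ}
    (hx : x ∈ triangle s τ₀) :
    ENNReal.ofReal (H θ V k τ₀ φ x) ≤
      spectralDist θ (vectorState 0 V) (torusState θ V k τ₀ φ) := by
  obtain ⟨T, D⟩ := x
  obtain ⟨hT, hD, hTD⟩ := hx
  simp only at hT hD hTD
  have hD' : s * D = |D| := by
    rcases hs with rfl | rfl
    · rw [one_mul, abs_of_nonneg (by linarith)]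
    · rw [abs_of_nonpos (by linarith)]
      ring
  rw [hD', le_min_iff] at hTD
  set κ := (Complex.exp (Complex.I * ((φ + ((k + 1 : ℤ) : ℝ) * (hol θ 0 - hol θ 1) : ℝ) : ℂ)) - 1) /
    (Complex.exp (Complex.I * ((hol θ 0 - hol θ 1 : ℝ) : ℂ)) - 1) with hκ
  set κ' := (Complex.exp (Complex.I * ((φ + k * (hol θ 0 - hol θ 1) : ℝ) : ℂ)) - 1) /
    (Complex.exp (Complex.I * ((hol θ 0 - hol θ 1 : ℝ) : ℂ)) - 1) with hκ'
  set z := star (V 0) * V 1 with hz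
  set η := Complex.exp (Complex.I * ((hol θ 0 - hol θ 1 : ℝ) : ℂ)) with hη
  have hη1 : η - 1 ≠ 0 := by rwa [sub_ne_zero, Ne, hη, hol_sub, ← far_iff_exp]
  obtain ⟨u, hu, hzu⟩ := exists_unit_mul (z * κ)
  obtain ⟨u', hu', hzu'⟩ := exists_unit_mul (z * κ')
  set g : ℂ := u * √((τ₀ - T) ^ 2 - D ^ 2) with hg
  set g' : ℂ := u' * √((2 * Real.pi - τ₀ - T) ^ 2 - D ^ 2) with hg'
  have hng : ‖g‖ = √((τ₀ - T) ^ 2 - D ^ 2) := by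
    rw [hg, norm_mul, hu, one_mul, Complex.norm_real, Real.norm_of_nonneg (Real.sqrt_nonneg _)]
  have hng' : ‖g'‖ = √((2 * Real.pi - τ₀ - T) ^ 2 - D ^ 2) := by
    rw [hg', norm_mul, hu', one_mul, Complex.norm_real, Real.norm_of_nonneg (Real.sqrt_nonneg _)]
  -- The increments over one turn must sum to `(η - 1)β`. Nontrivial holonomy allows solving for
  -- `β`, whence the free choice of both `g` and `g'`.
  set β := (g + g') / (η - 1) with hβ
  have hβη : η * β - β = g + g' := by
    rw [hβ]
    field_simp
  set B₀ := herm2 0 0 β with hB₀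
  set B₁ := herm2 T D (β + g) with hB₁
  have eX : B₁ - B₀ = herm2 T D g := by
    ext i j
    fin_cases i <;> fin_cases j <;> simp [hB₀, hB₁, herm2]
  have eY : gauge (hol θ) B₀ - B₁ = herm2 (-T) (-D) g' := by
    have h01 : (gauge (hol θ) B₀ - B₁) 0 1 = g' := by
      rw [Matrix.sub_apply, gauge_apply, ← hη]
      simp only [hB₀, hB₁, herm2, Matrix.of_apply, Matrix.cons_val_zero, Matrix.cons_val',
        Matrix.cons_val_one, Matrix.cons_val_fin_one]
      linear_combination hβη
    rw [eq_herm2 (M := gauge (hol θ) B₀ - B₁) (by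
      rw [Matrix.conjTranspose_sub, ← gauge_star, hB₀, hB₁, herm2_conjTranspose,
        herm2_conjTranspose]), h01]
    simp only [Matrix.sub_apply, gauge_apply_self, hB₀, hB₁, herm2, Matrix.of_apply,
      Matrix.cons_val_zero, Matrix.cons_val', Matrix.cons_val_one, Matrix.cons_val_fin_one,
      Complex.sub_re, Complex.add_re, Complex.ofReal_re]
    congr 1
    ring_nf
  have key := le_spectralDist hθ hper h0 h1 k hV (rotate_unit hV φ) (B₀ := B₀) (B₁ := B₁)
    (by
      rw [eX, norm_herm2_le_iff, abs_of_nonneg hT]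
      exact ⟨hTD.1, hng.le⟩)
    (by
      rw [eY, norm_herm2_le_iff, abs_neg, abs_neg, neg_sq, abs_of_nonneg hT]
      exact ⟨hTD.2, hng'.le⟩)
  rw [torusState, rotate_liftVec]
  refine le_trans (ENNReal.ofReal_le_ofReal ?_) key
  rw [state_sub hV φ k (hol θ) (herm2_conjTranspose _ _ _) (herm2_conjTranspose _ _ _) eX,
    combination_eq hfar, ← Int.cast_one (R := ℝ), ← Int.cast_add, ← hη, ← hz]
  have e1 : B₁ 0 1 - B₀ 0 1 = g := by simp [hB₀, hB₁, herm2]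
  have e2 : η * B₀ 0 1 - B₁ 0 1 = g' := by
    simp only [hB₀, hB₁, herm2, Matrix.of_apply, Matrix.cons_val_zero, Matrix.cons_val',
        Matrix.cons_val_one, Matrix.cons_val_fin_one]
    linear_combination hβη
  have e3 : z * (κ * g + κ' * g') = ((‖z * κ‖ * √((τ₀ - T) ^ 2 - D ^ 2) +
      ‖z * κ'‖ * √((2 * Real.pi - τ₀ - T) ^ 2 - D ^ 2) : ℝ) : ℂ) := by
    push_cast
    rw [← hzu, ← hzu', hg, hg']
    ring
  rw [e1, e2, ← hκ, ← hκ', e3, Complex.ofReal_re, Complex.norm_real, Real.norm_eq_abs, abs_neg]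
  refine le_trans (le_of_eq ?_) (le_abs_self _)
  rw [H, radius_eq hV, ← norm_coefficient φ (k + 1), ← norm_coefficient φ k, ← hκ, ← hκ', ← hz,
    norm_mul z κ, norm_mul z κ']
  ring

/-- The spectral distance on the torus when the holonomy is not trivial. -/
theorem spectralDist_torusState_eq (hθ : ∀ j, ContDiff ℝ ∞ (θ j))
    (hper : ∀ j, Function.Periodic (θ j) (2 * Real.pi)) {V : Fin 2 → ℂ} (hV : star V ⬝ᵥ V = 1)
    (hfar : ¬ Far θ 0 1) (k : ℤ) {τ₀ : ℝ} (φ : ℝ)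
    (h0 : 0 ≤ τ₀) (h1 : τ₀ ≤ 2 * Real.pi) {s : ℝ} (hs : s = 1 ∨ s = -1)
    (hsz : 0 ≤ s * altitude V) :
    ∃ M : ℝ, IsGreatest (H θ V k τ₀ φ '' triangle s τ₀) M ∧
      spectralDist θ (vectorState 0 V) (torusState θ V k τ₀ φ) = ENNReal.ofReal M := by
  have hne : (triangle s τ₀).Nonempty :=
    ⟨(0, 0), by simp [triangle, h0, h1]⟩
  obtain ⟨x, hx, hmax⟩ := (triangle_isCompact hs τ₀).exists_isMaxOn hne
    (continuous_H (θ := θ) V k τ₀ φ).continuousOn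
  refine ⟨H θ V k τ₀ φ x, ⟨⟨x, hx, rfl⟩, ?_⟩, le_antisymm ?_ ?_⟩
  · rintro _ ⟨y, hy, rfl⟩
    exact hmax hy
  · exact spectralDist_torusState_le hθ hper hV hfar k h0 h1 hs hsz fun y hy => hmax hy
  · exact ofReal_H_le_spectralDist hθ hper hV hfar k h0 h1 hs hx

end NontrivialHolonomy

/-! ### Coordinates on the torus and its separation from the other states. -/

variable {θ : Fin 2 → ℝ → ℝ}

lemma liftVec_phase {n : ℕ} (θ : Fin n → ℝ → ℝ) (U : Fin n → ℂ) (t : ℝ) :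
    liftVec θ (phase (fun j => Theta θ j t) U) t = U := by
  funext j
  simp only [liftVec, phase]
  rw [mul_right_comm, ← Complex.exp_add, add_neg_cancel, Complex.exp_zero, one_mul]

lemma norm_phase_apply {n : ℕ} (x : Fin n → ℝ) (U : Fin n → ℂ) (j : Fin n) :
    ‖phase x U j‖ = ‖U j‖ := by
  simp [phase]

lemma norm_rotate_apply (φ : ℝ) (U : Fin 2 → ℂ) (j : Fin 2) : ‖rotate φ U j‖ = ‖U j‖ := by
  fin_cases j <;> simp [rotate]

lemma vectorState_smul {n : ℕ} (t : ℝ) (U : Fin n → ℂ) {c : ℂ} (hc : ‖c‖ = 1) :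
    vectorState t (c • U) = vectorState t U := by
  ext a
  have : star c * c = 1 := by
    rw [Complex.star_def, Complex.conj_mul', hc]
    simp
  rw [vectorState_apply, vectorState_apply, Matrix.mulVec_smul, star_smul, smul_dotProduct,
    dotProduct_smul, smul_smul, this, one_smul]

lemma liftVec_smul {n : ℕ} (θ : Fin n → ℝ → ℝ) (U : Fin n → ℂ) (t : ℝ) (c : ℂ) :
    liftVec θ (c • U) t = c • liftVec θ U t := by
  funext j
  simp [liftVec, mul_assoc]

lemma exists_exp_mul_of_norm_eq {a b : ℂ} (h : ‖a‖ = ‖b‖) :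
    ∃ α : ℝ, a = Complex.exp (Complex.I * (α : ℂ)) * b := by
  refine ⟨a.arg - b.arg, ?_⟩
  have e : Complex.exp (a.arg * Complex.I) =
      Complex.exp (Complex.I * ((a.arg - b.arg : ℝ) : ℂ)) * Complex.exp (b.arg * Complex.I) := by
    rw [← Complex.exp_add]
    congr 1
    push_cast
    ring
  calc a = ‖a‖ * Complex.exp (a.arg * Complex.I) := (Complex.norm_mul_exp_arg_mul_I a).symm
    _ = Complex.exp (Complex.I * ((a.arg - b.arg : ℝ) : ℂ)) * b := by
      rw [h, e, mul_left_comm, Complex.norm_mul_exp_arg_mul_I b]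

/-- A common phase is factored out, leaving only the relative phase `φ`. -/
lemma exists_smul_rotate {U V : Fin 2 → ℂ} (h : ∀ j, ‖U j‖ = ‖V j‖) :
    ∃ (c : ℂ) (φ : ℝ), ‖c‖ = 1 ∧ U = c • rotate φ V := by
  obtain ⟨α, hα⟩ := exists_exp_mul_of_norm_eq (h 0)
  obtain ⟨β, hβ⟩ := exists_exp_mul_of_norm_eq (h 1)
  refine ⟨Complex.exp (Complex.I * (α : ℂ)), β - α, norm_exp_I_mul α, ?_⟩
  funext j
  fin_cases j
  · simpa [rotate] using hα
  · simp only [rotate, Fin.mk_one, Pi.smul_apply, Matrix.cons_val_one, Matrix.cons_val_fin_one,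
      smul_eq_mul]
    rw [hβ, ← mul_assoc, ← Complex.exp_add]
    congr 2
    push_cast
    ring

lemma mem_torus {U V : Fin 2 → ℂ} (h : ∀ j, ‖U j‖ = ‖V j‖) (t : ℝ) : vectorState t U ∈ torus V := by
  obtain ⟨c, φ, hc, rfl⟩ := exists_smul_rotate h
  exact ⟨t, φ, vectorState_smul t _ hc⟩

lemma exists_coordinate (t : ℝ) :
    ∃ (k : ℤ) (τ₀ : ℝ), 0 ≤ τ₀ ∧ τ₀ ≤ 2 * Real.pi ∧ t = 2 * k * Real.pi + τ₀ := by
  have hpi := Real.two_pi_pos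
  refine ⟨⌊t / (2 * Real.pi)⌋, t - 2 * ⌊t / (2 * Real.pi)⌋ * Real.pi, ?_, ?_, by ring⟩
  · have := (le_div_iff₀ hpi).1 (Int.floor_le (t / (2 * Real.pi)))
    linarith
  · have := (div_lt_iff₀ hpi).1 (Int.lt_floor_add_one (t / (2 * Real.pi)))
    linarith

lemma exists_eq_torusState (θ : Fin 2 → ℝ → ℝ) {U V : Fin 2 → ℂ} (h : ∀ j, ‖U j‖ = ‖V j‖) (t : ℝ) :
    ∃ (k : ℤ) (τ₀ φ : ℝ), 0 ≤ τ₀ ∧ τ₀ ≤ 2 * Real.pi ∧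
      vectorState t U = torusState θ V k τ₀ φ := by
  obtain ⟨k, τ₀, h0, h1, rfl⟩ := exists_coordinate t
  set t := 2 * k * Real.pi + τ₀ with ht
  obtain ⟨c, φ, hc, hU⟩ := exists_smul_rotate (U := phase (fun j => Theta θ j t) U) (V := V)
    fun j => by rw [norm_phase_apply, h]
  refine ⟨k, τ₀, φ, h0, h1, ?_⟩
  rw [torusState, ← ht, rotate_liftVec, ← vectorState_smul t (liftVec θ _ t) hc, ← liftVec_smul,
    ← hU, liftVec_phase]

lemma torusState_mem_pureStates {V : Fin 2 → ℂ} (hV : star V ⬝ᵥ V = 1) (k : ℤ) (τ₀ φ : ℝ) :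
    torusState θ V k τ₀ φ ∈ pureStates 2 :=
  ⟨_, _, rotate_unit (liftVec_unit θ hV _) φ, rfl⟩

lemma eq_top_of_forall_mul_le {d : ℝ≥0∞} {K : ℝ} (hK : 0 < K)
    (h : ∀ c : ℝ, 0 ≤ c → ENNReal.ofReal (c * K) ≤ d) : d = ⊤ := by
  by_contra hd
  have h1 := h ((d.toReal + 1) / K) (by positivity)
  rw [div_mul_cancel₀ _ hK.ne', ENNReal.ofReal_le_iff_le_toReal hd] at h1
  linarith

/-- Pure states at finite spectral distance have components of the same moduli. -/
lemma norm_eq_of_spectralDist_lt_top (hθ : ∀ j, ContDiff ℝ ∞ (θ j))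
    (hper : ∀ j, Function.Periodic (θ j) (2 * Real.pi)) {U V : Fin 2 → ℂ} (hV : star V ⬝ᵥ V = 1)
    (hU : star U ⬝ᵥ U = 1) {t : ℝ} (h : spectralDist θ (vectorState 0 V) (vectorState t U) < ⊤) :
    ∀ j, ‖U j‖ = ‖V j‖ := by
  have h0V := unit_sum_sq hV
  have h0U := unit_sum_sq hU
  have key : ‖U 0‖ ^ 2 = ‖V 0‖ ^ 2 := by
    by_contra hne
    have hK : 0 < |‖V 0‖ ^ 2 - ‖U 0‖ ^ 2| := abs_pos.2 (sub_ne_zero.2 (Ne.symm hne))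
    refine h.ne (eq_top_of_forall_mul_le hK fun c hc => ?_)
    obtain ⟨k, τ₀, h0, h1, rfl⟩ := exists_coordinate t
    set t := 2 * k * Real.pi + τ₀ with ht
    set w := phase (fun j => Theta θ j t) U with hw
    have hwU : liftVec θ w t = U := liftVec_phase θ U t
    have hw1 : star w ⬝ᵥ w = 1 := by
      rw [unit_iff, hw, norm_phase_apply, norm_phase_apply, h0U]
    -- A diagonal matrix is fixed by every `gauge x`, so it is admissible as a constant for all `c`,
    -- while its gap between the states grows linearly in `c`.
    set B : Matrix (Fin 2) (Fin 2) ℂ := !![(c : ℂ), 0; 0, 0] with hB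
    have hg : ∀ x, gauge x B = B := fun x => by
      ext i j
      rw [gauge_apply]
      fin_cases i <;> fin_cases j <;> simp [hB]
    have hval : ∀ u : Fin 2 → ℂ, star u ⬝ᵥ B *ᵥ u = ((c * ‖u 0‖ ^ 2 : ℝ) : ℂ) := fun u => by
      simp only [dotProduct, Matrix.mulVec, Fin.sum_univ_two, hB, Pi.star_apply, Matrix.of_apply,
        Matrix.cons_val', Matrix.cons_val_zero, Matrix.cons_val_one, Matrix.cons_val_fin_one,
        zero_mul, add_zero, mul_zero]
      push_cast
      rw [← Complex.conj_mul', Complex.star_def]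
      ring
    have := le_spectralDist hθ hper h0 h1 k hV hw1 (B₀ := B) (B₁ := B) (by simpa using h0)
      (by rw [hg]; simpa using h1)
    rw [hg, hval, hval, ← ht, hwU, ← Complex.ofReal_sub, ← mul_sub, Complex.norm_real, norm_mul,
      Real.norm_of_nonneg hc, Real.norm_eq_abs, hw, norm_phase_apply] at this
    exact this
  have key' : ‖U 1‖ ^ 2 = ‖V 1‖ ^ 2 := by linarith
  intro j
  fin_cases j
  · exact (sq_eq_sq₀ (norm_nonneg _) (norm_nonneg _)).1 key
  · exact (sq_eq_sq₀ (norm_nonneg _) (norm_nonneg _)).1 key'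

/-! ### Trivial holonomy. -/

section TrivialHolonomy

lemma exp_int_mul_hol_sub (hfar : Far θ 0 1) (k : ℤ) :
    Complex.exp (Complex.I * ((k * (hol θ 0 - hol θ 1) : ℝ) : ℂ)) = 1 := by
  rw [far_iff_exp, ← hol_sub] at hfar
  rw [Complex.ofReal_mul, mul_left_comm, Complex.ofReal_intCast, Complex.exp_int_mul, hfar,
    one_zpow]

lemma gauge_hol_of_far (hfar : Far θ 0 1) (k : ℤ) (M : Matrix (Fin 2) (Fin 2) ℂ) :
    gauge ((k : ℝ) • hol θ) M = M := by
  ext i j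
  rw [gauge_apply]
  fin_cases i <;> fin_cases j
  · simp
  · have := exp_int_mul_hol_sub hfar k
    simp only [Fin.zero_eta, Fin.mk_one, Pi.smul_apply, smul_eq_mul, ← mul_sub, this, one_mul]
  · have := exp_int_mul_hol_sub hfar (-k)
    rw [Int.cast_neg, neg_mul, ← mul_neg, neg_sub] at this
    simp only [Fin.zero_eta, Fin.mk_one, Pi.smul_apply, smul_eq_mul, ← mul_sub, this, one_mul]
  · simp

lemma gauge_hol_of_far' (hfar : Far θ 0 1) (M : Matrix (Fin 2) (Fin 2) ℂ) :
    gauge (hol θ) M = M := by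
  simpa using gauge_hol_of_far hfar 1 M

lemma exp_I_mul_eq_one_iff (φ : ℝ) :
    Complex.exp (Complex.I * (φ : ℂ)) = 1 ↔ ∃ m : ℤ, φ = 2 * Real.pi * m := by
  rw [Complex.exp_eq_one_iff]
  refine exists_congr fun m => ?_
  rw [show (m : ℂ) * (2 * Real.pi * Complex.I) = Complex.I * ((2 * Real.pi * m : ℝ) : ℂ) by
    push_cast; ring, mul_right_inj' Complex.I_ne_zero, Complex.ofReal_inj]

/-- Rotations by multiples of `2π`, and all rotations of a pole, do not change the state. -/
lemma torusState_eq_liftVec {V : Fin 2 → ℂ} (hV : star V ⬝ᵥ V = 1) {φ : ℝ}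
    (h : (∃ m : ℤ, φ = 2 * Real.pi * m) ∨ radius V = 0) (k : ℤ) (τ₀ : ℝ) :
    torusState θ V k τ₀ φ =
      vectorState (2 * k * Real.pi + τ₀) (liftVec θ V (2 * k * Real.pi + τ₀)) := by
  obtain ⟨c, hc, hcV⟩ : ∃ c : ℂ, ‖c‖ = 1 ∧ rotate φ V = c • V := by
    -- At a pole one component vanishes and the rotation acts as a global phase: `1` if `V 1 = 0`,
    -- and `e^{iφ}` if `V 0 = 0`.
    by_cases h1 : V 1 = 0
    · refine ⟨1, by simp, ?_⟩
      funext j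
      fin_cases j <;> simp [rotate, h1]
    refine ⟨Complex.exp (Complex.I * (φ : ℂ)), norm_exp_I_mul φ, ?_⟩
    rcases h with h | h
    · have := (exp_I_mul_eq_one_iff φ).2 h
      funext j
      fin_cases j <;> simp [rotate, this]
    · have h0 : V 0 = 0 := by
        rw [radius_eq hV] at h
        simpa [h1] using h
      funext j
      fin_cases j <;> simp [rotate, h0]
  rw [torusState, rotate_liftVec, hcV, liftVec_smul, vectorState_smul _ _ hc]

/-- With trivial holonomy both states read the same vector on `B₀` and `B₁`, so the gap is at most
the norm of `B₀ - B₁`, which is bounded by both arcs. A scalar increment attains the bound. -/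
lemma spectralDist_liftVec_of_far (hθ : ∀ j, ContDiff ℝ ∞ (θ j))
    (hper : ∀ j, Function.Periodic (θ j) (2 * Real.pi)) {V : Fin 2 → ℂ} (hV : star V ⬝ᵥ V = 1)
    (hfar : Far θ 0 1) (k : ℤ) {τ₀ : ℝ} (h0 : 0 ≤ τ₀) (h1 : τ₀ ≤ 2 * Real.pi) :
    spectralDist θ (vectorState 0 V)
      (vectorState (2 * k * Real.pi + τ₀) (liftVec θ V (2 * k * Real.pi + τ₀))) =
      ENNReal.ofReal (min τ₀ (2 * Real.pi - τ₀)) := by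
  refine le_antisymm ?_ ?_
  · refine spectralDist_le (fun j => (hθ j).continuous) hper h0 h1 k _ _ fun B₀ B₁ _ _ hX hY => ?_
    rw [gauge_hol_of_far hfar, ← dotProduct_sub, ← Matrix.sub_mulVec]
    rw [gauge_hol_of_far' hfar] at hY
    refine (norm_star_dotProduct_mulVec_le _ hV).trans (le_min ?_ hY)
    rwa [norm_sub_rev]
  · set m := min τ₀ (2 * Real.pi - τ₀) with hm
    have hm0 : 0 ≤ m := le_min h0 (by linarith)
    have hn : ‖(m : ℂ) • (1 : Matrix (Fin 2) (Fin 2) ℂ)‖ = m := by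
      rw [norm_smul, norm_one, mul_one, Complex.norm_real, Real.norm_of_nonneg hm0]
    have := le_spectralDist hθ hper h0 h1 k hV hV (B₀ := 0)
      (B₁ := (m : ℂ) • (1 : Matrix (Fin 2) (Fin 2) ℂ))
      (by rw [sub_zero, hn]; exact min_le_left _ _)
      (by rw [map_zero, zero_sub, norm_neg, hn]; exact min_le_right _ _)
    rwa [gauge_hol_of_far hfar, Matrix.smul_mulVec, Matrix.one_mulVec, Matrix.zero_mulVec,
      dotProduct_zero, zero_sub, norm_neg, dotProduct_smul, hV, smul_eq_mul, mul_one,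
      Complex.norm_real, Real.norm_of_nonneg hm0] at this

/-- A constant off-diagonal matrix satisfies both constraints at any size, and the two states differ
on it as soon as `e^{iφ} ≠ 1` and `V` is not a pole. -/
lemma spectralDist_eq_top_of_far (hθ : ∀ j, ContDiff ℝ ∞ (θ j))
    (hper : ∀ j, Function.Periodic (θ j) (2 * Real.pi)) {V : Fin 2 → ℂ} (hV : star V ⬝ᵥ V = 1)
    (hfar : Far θ 0 1) (k : ℤ) {τ₀ φ : ℝ} (h0 : 0 ≤ τ₀) (h1 : τ₀ ≤ 2 * Real.pi)
    (hφ : ¬ ∃ m : ℤ, φ = 2 * Real.pi * m) (hR : radius V ≠ 0) :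
    spectralDist θ (vectorState 0 V) (torusState θ V k τ₀ φ) = ⊤ := by
  rw [torusState, rotate_liftVec]
  set z := star (V 0) * V 1 * (Complex.exp (Complex.I * (φ : ℂ)) - 1) with hz
  have hz0 : 0 < ‖z‖ := by
    rw [← exp_I_mul_eq_one_iff] at hφ
    rw [radius_eq hV] at hR
    rw [norm_pos_iff, hz]
    exact mul_ne_zero (fun h => hR (by rw [h, norm_zero, mul_zero])) (sub_ne_zero.2 hφ)
  obtain ⟨u, hu, hzu⟩ := exists_unit_mul z
  -- The factor `2` comes from the two conjugate off-diagonal entries; the phase `u` makes their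
  -- contribution real.
  refine eq_top_of_forall_mul_le (K := 2 * ‖z‖) (by positivity) fun c hc => ?_
  have key := le_spectralDist hθ hper h0 h1 k hV (rotate_unit hV φ) (B₀ := herm2 0 0 (c * u))
    (B₁ := herm2 0 0 (c * u)) (by simpa using h0)
    (by rw [gauge_hol_of_far' hfar]; simpa using h1)
  refine le_trans (ENNReal.ofReal_le_ofReal ?_) key
  have e : herm2 0 0 (c * u) - herm2 0 0 (c * u) = herm2 0 0 0 := by
    ext i j
    fin_cases i <;> fin_cases j <;> simp [herm2]
  have e1 : Complex.exp (Complex.I * ((φ + k * (hol θ 0 - hol θ 1) : ℝ) : ℂ)) =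
      Complex.exp (Complex.I * (φ : ℂ)) := by
    rw [Complex.ofReal_add, mul_add, Complex.exp_add, exp_int_mul_hol_sub hfar, mul_one]
  have e2 : herm2 0 0 (c * u) 0 1 = c * u := by simp [herm2]
  have e3 : star (V 0) * V 1 * (Complex.exp (Complex.I * (φ : ℂ)) * (c * u) - c * u) =
      ((c * ‖z‖ : ℝ) : ℂ) := by
    push_cast
    rw [← hzu, hz]
    ring
  rw [state_sub hV φ k (hol θ) (herm2_conjTranspose _ _ _) (herm2_conjTranspose _ _ _) e, e1, e2,
    e3, Complex.ofReal_re, Complex.norm_real, Real.norm_eq_abs, abs_neg]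
  refine le_trans (le_of_eq ?_) (le_abs_self _)
  ring

end TrivialHolonomy

/-! ### The sets of states at finite distance. -/

/-- Finite horizontal distance always gives finite spectral distance. Conversely, finite spectral
distance forces the state onto the torus, then forces a trivial rotation or a pole, so that the
state is a parallel transport of `V`. -/
lemma Con_eq_Acc (hθ : ∀ j, ContDiff ℝ ∞ (θ j))
    (hper : ∀ j, Function.Periodic (θ j) (2 * Real.pi)) {V : Fin 2 → ℂ} (hV : star V ⬝ᵥ V = 1)
    (hfar : Far θ 0 1) : Con θ (vectorState 0 V) = Acc θ (vectorState 0 V) := by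
  have hθc : ∀ j, Continuous (θ j) := fun j => (hθ j).continuous
  refine Set.Subset.antisymm ?_ fun q hq =>
    ⟨hq.1, spectralDist_lt_top_of_horizontalDist hθc hper hq.2⟩
  rintro q ⟨hq, hd⟩
  refine ⟨hq, ?_⟩
  obtain ⟨t, U, hU, rfl⟩ := hq
  obtain ⟨k, τ₀, φ, h0, h1, e⟩ :=
    exists_eq_torusState θ (norm_eq_of_spectralDist_lt_top hθ hper hV hU hd) t
  rw [e] at hd ⊢
  have h : (∃ m : ℤ, φ = 2 * Real.pi * m) ∨ radius V = 0 := by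
    by_contra! hcon
    refine hd.ne (spectralDist_eq_top_of_far hθ hper hV hfar k h0 h1 ?_ hcon.2)
    push Not
    exact hcon.1
  rw [torusState_eq_liftVec hV h]
  exact horizontalDist_liftVec_lt_top hθc V _

lemma Con_eq_torus (hθ : ∀ j, ContDiff ℝ ∞ (θ j))
    (hper : ∀ j, Function.Periodic (θ j) (2 * Real.pi)) {V : Fin 2 → ℂ} (hV : star V ⬝ᵥ V = 1)
    (hfar : ¬ Far θ 0 1) : Con θ (vectorState 0 V) = torus V := by
  ext q
  constructor
  · rintro ⟨⟨t, U, hU, rfl⟩, hd⟩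
    exact mem_torus (norm_eq_of_spectralDist_lt_top hθ hper hV hU hd) t
  · rintro ⟨t, φ, rfl⟩
    obtain ⟨k, τ₀, φ', h0, h1, e⟩ := exists_eq_torusState θ (norm_rotate_apply φ V) t
    rw [e]
    refine ⟨torusState_mem_pureStates hV k τ₀ φ', ?_⟩
    obtain ⟨s, hs, hsz⟩ : ∃ s : ℝ, (s = 1 ∨ s = -1) ∧ 0 ≤ s * altitude V := by
      rcases le_total 0 (altitude V) with h | h
      · exact ⟨1, Or.inl rfl, by linarith⟩
      · exact ⟨-1, Or.inr rfl, by linarith⟩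
    obtain ⟨M, -, hM⟩ := spectralDist_torusState_eq hθ hper hV hfar k φ' h0 h1 hs hsz
    rw [hM]
    exact ENNReal.ofReal_lt_top

end SpectralCircle

end

theorem mainTheorem2 (θ : Fin 2 → ℝ → ℝ) (hθ : ∀ j, ContDiff ℝ ∞ (θ j))
    (hper : ∀ j, Function.Periodic (θ j) (2 * Real.pi))
    (V : Fin 2 → ℂ) (hV : star V ⬝ᵥ V = 1) :
    (SpectralCircle.Far θ 0 1 →
      SpectralCircle.Con θ (SpectralCircle.vectorState 0 V) =
          SpectralCircle.Acc θ (SpectralCircle.vectorState 0 V) ∧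
        ∀ (k : ℤ) (τ₀ φ : ℝ), 0 ≤ τ₀ → τ₀ ≤ 2 * Real.pi →
          (((∃ m : ℤ, φ = 2 * Real.pi * m) ∨ SpectralCircle.radius V = 0) →
            SpectralCircle.spectralDist θ (SpectralCircle.vectorState 0 V)
                (SpectralCircle.torusState θ V k τ₀ φ) =
              ENNReal.ofReal (min τ₀ (2 * Real.pi - τ₀))) ∧
          ((¬ ∃ m : ℤ, φ = 2 * Real.pi * m) → SpectralCircle.radius V ≠ 0 →
            SpectralCircle.spectralDist θ (SpectralCircle.vectorState 0 V)
                (SpectralCircle.torusState θ V k τ₀ φ) = ⊤)) ∧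
    (¬ SpectralCircle.Far θ 0 1 →
      SpectralCircle.Con θ (SpectralCircle.vectorState 0 V) = SpectralCircle.torus V ∧
        ∀ (k : ℤ) (τ₀ φ : ℝ), 0 ≤ τ₀ → τ₀ ≤ 2 * Real.pi →
          ∀ s : ℝ, (s = 1 ∨ s = -1) → 0 ≤ s * SpectralCircle.altitude V →
            ∃ M : ℝ,
              IsGreatest (SpectralCircle.H θ V k τ₀ φ '' SpectralCircle.triangle s τ₀) M ∧
              SpectralCircle.spectralDist θ (SpectralCircle.vectorState 0 V)
                (SpectralCircle.torusState θ V k τ₀ φ) = ENNReal.ofReal M) := by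
  refine ⟨fun hfar => ⟨SpectralCircle.Con_eq_Acc hθ hper hV hfar, fun k τ₀ φ h0 h1 => ⟨fun h => ?_,
    fun hφ hR => SpectralCircle.spectralDist_eq_top_of_far hθ hper hV hfar k h0 h1 hφ hR⟩⟩,
    fun hfar => ⟨SpectralCircle.Con_eq_torus hθ hper hV hfar, fun k τ₀ φ h0 h1 s hs hsz =>
      SpectralCircle.spectralDist_torusState_eq hθ hper hV hfar k φ h0 h1 hs hsz⟩⟩
  rw [SpectralCircle.torusState_eq_liftVec hV h]
  exact SpectralCircle.spectralDist_liftVec_of_far hθ hper hV hfar k h0 h1
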